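/- Let $G=(V,E)$ be a finite simple graph with $n=|V|\ge 1$ vertices, minimum degree $d$ and maximum degree $\Delta$. Write $[k]=\{1,\dots,k\}$. A $k$-lift of $G$ is a graph with vertex set $V\times[k]$ whose edge set is $\bigcup_{vw\in E}M_{vw}$, where each $M_{vw}$ is a perfect matching between $\{v\}\times[k]$ and $\{w\}\times[k]$. It is a maximally random $k$-lift if the matchings $M_{vw}$ ($vw\in E$) are independent and each of them is uniformly distributed over all perfect matchings between $\{v\}\times[k]$ and $\{w\}\times[k]$. Let $k=k_1k_2\cdots k_s$ with integers $k_1,\dots,k_s\ge 2$. Let $G^{(k)}$ be a maximally random $k$-lift of $G$, and let $\tilde G^{(k)}=G_s$, where $G_0=G$ and, for $1\le i\le s$, conditionally on $G_0,\dots,G_{i-1}$, the graph $G_i$ is a maximally random $k_i$-lift of $G_{i-1}$. The two random graphs are defined on a common probability space, with an arbitrary joint distribution. For a finite graph $H$, let $A_H$ be its adjacency matrix and let $\mathcal L_H=I-T_HA_HT_H$ be its Laplacian, where $T_H$ is the diagonal matrix with entries $\deg_H(x)^{-1/2}$ (or $0$ if $\deg_H(x)=0$). Let $\|\cdot\|$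 be the operator norm with respect to the Euclidean norm. Then there is a bijection from the vertex set of $\tilde G^{(k)}$ to $V\times[k]$, which depends only on $V$ and $k_1,\dots,k_s$ and not on the random graphs, such that, after relabelling the vertices of $\tilde G^{(k)}$ by it, for every $\delta\in(0,1)$ $$\mathbb P\left(\|A_{G^{(k)}}-A_{\tilde G^{(k)}}\|\le 32\sqrt{\Delta\ln(4nk/\delta)}\right)\ge 1-\delta$$ and, if $d\ge 1$, $$\mathbb P\left(\|\mathcal L_{G^{(k)}}-\mathcal L_{\tilde G^{(k)}}\|\le 32\sqrt{\frac{\ln(4nk/\delta)}{d}}\right)\ge 1-\delta.$$ -/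

import Mathlib

universe u

open MeasureTheory ProbabilityTheory

noncomputable section

namespace GraphLift

/-- `M` is a (perfect) matching of the sets `A` and `B`: a set of unordered pairs `{a, f a}`, where
`f` is a bijection from `A` to `B`. -/
def IsMatchingOf {α : Type u} (A B : Set α) (M : Set (Sym2 α)) : Prop :=
  ∃ f : A ≃ B, M = Set.range (fun a : A => s((a : α), (f a : α)))

/-- The set `{v} × [k]` of the `k` copies of the vertex `v`. -/
def fibre {V : Type u} (k : ℕ) (v : V) : Set (V × Fin k) := {p | p.1 = v}

/-- The matchings available for an edge `e`: if `e = vw`, these are the matchings of `{v} × [k]`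
and `{w} × [k]`. -/
def EdgeMatching {V : Type u} (k : ℕ) (e : Sym2 V) : Type u :=
  {M : Set (Sym2 (V × Fin k)) // ∀ v w : V, e = s(v, w) → IsMatchingOf (fibre k v) (fibre k w) M}

/-- The data that determine a `k`-lift of `G`: a matching for every edge of `G`. -/
abbrev MatchingFamily {V : Type u} (G : SimpleGraph V) (k : ℕ) : Type u :=
  (e : G.edgeSet) → EdgeMatching k (e : Sym2 V)

/-- The `k`-lift of `G` determined by a family of matchings: its vertex set is `V × [k]` and its
edge set is the union of the matchings. -/
def lift {V : Type u} {G : SimpleGraph V} {k : ℕ} (M : MatchingFamily G k) :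
    SimpleGraph (V × Fin k) :=
  SimpleGraph.fromEdgeSet (⋃ e : G.edgeSet, (M e).1)

lemma IsMatchingOf.symm {α : Type u} {A B : Set α} {M : Set (Sym2 α)} (h : IsMatchingOf A B M) :
    IsMatchingOf B A M := by
  obtain ⟨f, rfl⟩ := h
  refine ⟨f.symm, ?_⟩
  ext z
  constructor
  · rintro ⟨a, rfl⟩
    exact ⟨f a, by simp [Sym2.eq_swap]⟩
  · rintro ⟨b, rfl⟩
    exact ⟨f.symm b, by simp [Sym2.eq_swap]⟩

/-- The identification of the copies of `v` with the copies of `w`. -/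
def fibreEquiv {V : Type u} (k : ℕ) (v w : V) : fibre k v ≃ fibre k w where
  toFun p := ⟨(w, p.1.2), rfl⟩
  invFun p := ⟨(v, p.1.2), rfl⟩
  left_inv := by rintro ⟨⟨x, i⟩, rfl⟩; rfl
  right_inv := by rintro ⟨⟨x, i⟩, rfl⟩; rfl

instance {V : Type u} (k : ℕ) (e : Sym2 V) : Nonempty (EdgeMatching k e) := by
  induction e using Sym2.ind with
  | _ x y =>
    have h : IsMatchingOf (fibre k x) (fibre k y)
        (Set.range (fun a : fibre k x =>
          s((a : V × Fin k), (fibreEquiv k x y a : V × Fin k)))) :=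
      ⟨fibreEquiv k x y, rfl⟩
    refine ⟨⟨Set.range (fun a : fibre k x =>
      s((a : V × Fin k), (fibreEquiv k x y a : V × Fin k))), ?_⟩⟩
    intro v w hvw
    rcases Sym2.eq_iff.mp hvw with ⟨rfl, rfl⟩ | ⟨rfl, rfl⟩
    · exact h
    · exact h.symm

instance {V : Type u} [Finite V] (k : ℕ) (e : Sym2 V) : Finite (EdgeMatching k e) := by
  unfold EdgeMatching
  infer_instance

instance {V : Type u} [Finite V] (G : SimpleGraph V) (k : ℕ) : Fintype (MatchingFamily G k) :=
  Fintype.ofFinite _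

/-- The law of the maximally random `k`-lift of `G`. The family of matchings is uniformly
distributed over the product of the (finite, nonempty) sets of available matchings, that is, the
matchings are independent and each of them is uniformly distributed. -/
def randomLift {V : Type u} [Finite V] (G : SimpleGraph V) (k : ℕ) :
    PMF (SimpleGraph (V × Fin k)) :=
  (PMF.uniformOfFintype (MatchingFamily G k)).map lift

/-- The vertex set `(⋯((V × [k₁]) × [k₂]) × ⋯) × [kₛ]` of an iterated lift. -/
def IterVertex : (V : Type u) → List ℕ → Type u
  | V, [] => V
  | V, k :: ks => IterVertex (V × Fin k) ks

/-- The law of the iterated random lift `Gₛ`: here `G₀ = G` and, conditionally on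
`G₀, …, Gᵢ₋₁`, the graph `Gᵢ` is a maximally random `kᵢ`-lift of `Gᵢ₋₁`. -/
def iteratedLift : (ks : List ℕ) → {V : Type u} → [Finite V] → SimpleGraph V →
    PMF (SimpleGraph (IterVertex V ks))
  | [], _, _, G => PMF.pure G
  | k :: ks, _, _, G => (randomLift G k).bind (fun H => iteratedLift ks H)

open Classical in
/-- The real adjacency matrix of a graph. -/
def adj {W : Type u} (G : SimpleGraph W) : Matrix W W ℝ := G.adjMatrix ℝ

open Classical in
/-- The (normalized) Laplacian `I - T A T`, where `T` is the diagonal matrix with entries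
`deg(v)^(-1/2)`, or `0` if `deg(v) = 0`. -/
def laplacian {W : Type u} [Fintype W] (G : SimpleGraph W) : Matrix W W ℝ :=
  let T : Matrix W W ℝ :=
    Matrix.diagonal (fun v => if G.degree v = 0 then 0 else 1 / Real.sqrt (G.degree v))
  1 - T * adj G * T

open Classical in
/-- The operator norm of a real square matrix with respect to the Euclidean norm. -/
def opNorm {W : Type u} [Fintype W] (B : Matrix W W ℝ) : ℝ :=
  ‖Matrix.toEuclideanCLM (n := W) (𝕜 := ℝ) B‖

/-- The graph obtained from `H` by giving each vertex `x` the new label `φ x`. -/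
def relabel {W W' : Type u} (φ : W ≃ W') (H : SimpleGraph W) : SimpleGraph W' :=
  H.map φ.toEmbedding

end GraphLift

end

noncomputable section

namespace GraphLift

open Finset

/-! ### Trace inequalities for symmetric matrices -/

/-! Both random graphs are covers of `G` with the same mean adjacency matrix: `1/k` for two vertices
lying over adjacent vertices of `G`, and `0` otherwise. It is enough to show that each is within
half of the claimed distance of this mean, outside an event of probability `δ/2`; no property of the
joint law is needed.

The deviation `S` from the mean splits into blocks `X`, one for each edge `vw` of `G`. A twist over
`vw` permutes the ends over `w` of the edges between the two fibres. For both models there is a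
family of `k` permutations, simply transitive on the fibres and closed under inversion, whose twists
preserve the law (`isRandomCover_iteratedLift`; a plain lift is an iterated lift with one step). The
resampled matrix `S'` changes only the block `X`, to `X'`, and `X'` averages to zero over the family
(`IsCover.sum_block_twist`).

This is the setting of the method of exchangeable pairs. The sum over the edges of `E tr X S^(m+1)`
is `E tr S^(m+2)`, and by symmetrization each term is half the mean of `tr (S - S')(S^(m+1) -
S'^(m+1))`. The mean value inequality `trace_sub_mul_pow_sub_pow_le` leaves `(m+1)/2` times the mean
of `tr (X - X')² S^m`. As the blocks are matchings, the sum of the `(X - X')²` is at most `4s` times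
the identity (`posSemidef_variance`), where `s` is the maximum degree for the adjacency matrix and
`1/d` for the Laplacian. Iteration gives `E tr S^(2n) ≤ (4sn)^n N`, with `N` the number of vertices
of the cover, and Markov's inequality with `n` about `log (4N/δ)` gives the tail bound
(`IsRandomCover.exists_tail`). -/

lemma pow_mul_pow_add_le {b c : ℝ} {m j : ℕ} (hm : Even m) (hj : j ≤ m) :
    b ^ j * c ^ (m - j) + b ^ (m - j) * c ^ j ≤ b ^ m + c ^ m := by
  have key : ∀ x y : ℝ, 0 ≤ x → 0 ≤ y →
      x ^ j * y ^ (m - j) + x ^ (m - j) * y ^ j ≤ x ^ m + y ^ m := by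
    intro x y hx hy
    have h : 0 ≤ (x ^ j - y ^ j) * (x ^ (m - j) - y ^ (m - j)) := by
      rcases le_total x y with h | h
      · exact mul_nonneg_of_nonpos_of_nonpos (sub_nonpos.2 (pow_le_pow_left₀ hx h _))
          (sub_nonpos.2 (pow_le_pow_left₀ hx h _))
      · exact mul_nonneg (sub_nonneg.2 (pow_le_pow_left₀ hy h _))
          (sub_nonneg.2 (pow_le_pow_left₀ hy h _))
    have e1 : x ^ j * x ^ (m - j) = x ^ m := by rw [← pow_add, Nat.add_sub_cancel' hj]
    have e2 : y ^ j * y ^ (m - j) = y ^ m := by rw [← pow_add, Nat.add_sub_cancel' hj]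
    nlinarith
  have h := key |b| |c| (abs_nonneg _) (abs_nonneg _)
  rw [hm.pow_abs, hm.pow_abs] at h
  refine le_trans (add_le_add ?_ ?_) h
  · exact (le_abs_self _).trans (by rw [abs_mul, abs_pow, abs_pow])
  · exact (le_abs_self _).trans (by rw [abs_mul, abs_pow, abs_pow])

/-- Pair the term `j` with the term `m - j`: each of the `m + 1` pairs is at most `b ^ m + c ^ m`,
and the pairs count the sum twice. -/
lemma geom_sum₂_le {b c : ℝ} {m : ℕ} (hm : Even m) :
    ∑ j ∈ range (m + 1), b ^ j * c ^ (m - j) ≤ (m + 1) / 2 * (b ^ m + c ^ m) := by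
  have h1 : ∑ j ∈ range (m + 1), b ^ j * c ^ (m - j)
      = ∑ j ∈ range (m + 1), b ^ (m - j) * c ^ j := by
    rw [← sum_range_reflect]
    refine sum_congr rfl fun j hj => ?_
    have : j ≤ m := by simpa [Nat.lt_succ_iff] using hj
    simp only [Nat.add_sub_cancel, Nat.sub_sub_self this]
  have h2 : ∑ j ∈ range (m + 1), (b ^ j * c ^ (m - j) + b ^ (m - j) * c ^ j)
      ≤ ∑ _j ∈ range (m + 1), (b ^ m + c ^ m) :=
    sum_le_sum fun j hj => pow_mul_pow_add_le hm (by simpa [Nat.lt_succ_iff] using hj)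
  rw [sum_add_distrib, ← h1] at h2
  simp only [sum_const, card_range, nsmul_eq_mul] at h2
  push_cast at h2
  linarith

lemma sub_mul_pow_sub_pow_le {b c : ℝ} {m : ℕ} (hm : Even m) :
    (b - c) * (b ^ (m + 1) - c ^ (m + 1)) ≤ (m + 1) / 2 * ((b - c) ^ 2 * (b ^ m + c ^ m)) := by
  have h := geom_sum₂_mul b c (m + 1)
  simp only [Nat.add_sub_cancel] at h
  rw [← h]
  nlinarith [mul_le_mul_of_nonneg_left (geom_sum₂_le (b := b) (c := c) hm) (sq_nonneg (b - c))]

section Matrices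

variable {W : Type*} [Fintype W] [DecidableEq W]

lemma exists_diagonalization {B : Matrix W W ℝ} (hB : B.IsHermitian) :
    ∃ (U : Matrix W W ℝ) (b : W → ℝ), U.transpose * U = 1 ∧ U * U.transpose = 1 ∧
      ∀ n : ℕ, B ^ n = U * Matrix.diagonal (fun i => b i ^ n) * U.transpose := by
  have h1 : (hB.eigenvectorUnitary : Matrix W W ℝ).transpose * hB.eigenvectorUnitary = 1 :=
    Unitary.coe_star_mul_self hB.eigenvectorUnitary
  have h2 : (hB.eigenvectorUnitary : Matrix W W ℝ) * Matrix.transpose hB.eigenvectorUnitary.1 = 1 :=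
    Unitary.coe_mul_star_self hB.eigenvectorUnitary
  refine ⟨hB.eigenvectorUnitary, hB.eigenvalues, h1, h2, fun n => ?_⟩
  have h3 := hB.spectral_theorem
  have h4 : B ^ n = Unitary.conjStarAlgAut ℝ _ hB.eigenvectorUnitary
      (Matrix.diagonal (fun i => hB.eigenvalues i ^ n)) := by
    conv_lhs => rw [h3]
    rw [← map_pow, Matrix.diagonal_pow]
    rfl
  rw [h4, Unitary.conjStarAlgAut_apply]
  rfl

lemma trace_pow_eq_sum {B : Matrix W W ℝ} {U : Matrix W W ℝ} {b : W → ℝ}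
    (hU : U.transpose * U = 1)
    (hB : ∀ n : ℕ, B ^ n = U * Matrix.diagonal (fun i => b i ^ n) * U.transpose) (n : ℕ) :
    (B ^ n).trace = ∑ i, b i ^ n := by
  rw [hB, Matrix.trace_mul_comm, ← Matrix.mul_assoc, hU, Matrix.one_mul, Matrix.trace_diagonal]

/-- The weight `κ k l` is the squared inner product of the `k`-th eigenvector of `B` with the `l`-th
of `C`. Since `κ` is nonnegative and independent of the exponents, trace inequalities for two
noncommuting matrices reduce to scalar ones in their eigenvalues. -/
lemma exists_trace_pow_mul_pow {B C : Matrix W W ℝ} (hB : B.IsHermitian) (hC : C.IsHermitian) :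
    ∃ (b c : W → ℝ) (κ : W → W → ℝ), (∀ k l, 0 ≤ κ k l) ∧
      ∀ i j : ℕ, (B ^ i * C ^ j).trace = ∑ k, ∑ l, b k ^ i * c l ^ j * κ k l := by
  obtain ⟨U, b, -, -, hb⟩ := exists_diagonalization hB
  obtain ⟨Z, c, -, -, hc⟩ := exists_diagonalization hC
  refine ⟨b, c, fun k l => (U.transpose * Z) k l ^ 2, fun k l => sq_nonneg _, fun i j => ?_⟩
  have : (B ^ i * C ^ j).trace = (Matrix.diagonal (fun k => b k ^ i) * (U.transpose * Z) *
      (Matrix.diagonal (fun l => c l ^ j) * (U.transpose * Z).transpose)).trace := by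
    rw [hb, hc, Matrix.transpose_mul, Matrix.transpose_transpose]
    rw [show U * Matrix.diagonal (fun k => b k ^ i) * U.transpose *
      (Z * Matrix.diagonal (fun l => c l ^ j) * Z.transpose) =
      U * (Matrix.diagonal (fun k => b k ^ i) * U.transpose *
      (Z * Matrix.diagonal (fun l => c l ^ j) * Z.transpose)) by simp only [Matrix.mul_assoc]]
    rw [Matrix.trace_mul_comm]
    simp only [Matrix.mul_assoc]
  rw [this, Matrix.trace]
  refine sum_congr rfl fun k _ => ?_
  rw [Matrix.diag_apply, Matrix.mul_apply]
  refine sum_congr rfl fun l _ => ?_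
  rw [Matrix.diagonal_mul, Matrix.diagonal_mul, Matrix.transpose_apply]
  ring

/-- A mean value inequality for the trace of odd powers. -/
lemma trace_sub_mul_pow_sub_pow_le {B C : Matrix W W ℝ} (hB : B.IsHermitian) (hC : C.IsHermitian)
    {m : ℕ} (hm : Even m) :
    ((B - C) * (B ^ (m + 1) - C ^ (m + 1))).trace
      ≤ (m + 1) / 2 * ((B - C) ^ 2 * (B ^ m + C ^ m)).trace := by
  obtain ⟨b, c, κ, hκ, h⟩ := exists_trace_pow_mul_pow hB hC
  have e1 : ((B - C) * (B ^ (m + 1) - C ^ (m + 1))).trace =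
      (B ^ (m + 2) * C ^ 0).trace - (B ^ 1 * C ^ (m + 1)).trace - (B ^ (m + 1) * C ^ 1).trace
        + (B ^ 0 * C ^ (m + 2)).trace := by
    rw [show (B - C) * (B ^ (m + 1) - C ^ (m + 1)) = B ^ (m + 2) * C ^ 0 - B ^ 1 * C ^ (m + 1)
      - C * B ^ (m + 1) + B ^ 0 * C ^ (m + 2) by
        simp only [pow_zero, pow_one, Matrix.mul_one, Matrix.one_mul, pow_succ' _ (m + 1)]
        noncomm_ring]
    simp only [Matrix.trace_add, Matrix.trace_sub, Matrix.trace_mul_comm C, pow_one]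
  have e2 : ((B - C) ^ 2 * (B ^ m + C ^ m)).trace =
      (B ^ (m + 2) * C ^ 0).trace - 2 * (B ^ (m + 1) * C ^ 1).trace + (B ^ m * C ^ 2).trace
      + (B ^ 2 * C ^ m).trace - 2 * (B ^ 1 * C ^ (m + 1)).trace + (B ^ 0 * C ^ (m + 2)).trace := by
    rw [show (B - C) ^ 2 * (B ^ m + C ^ m) = B ^ (m + 2) * C ^ 0 - B * (C * B ^ m)
      - C * B ^ (m + 1) + C ^ 2 * B ^ m + B ^ 2 * C ^ m - B ^ 1 * C ^ (m + 1) - C * (B * C ^ m)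
      + B ^ 0 * C ^ (m + 2) by
        simp only [pow_zero, pow_one, Matrix.mul_one, Matrix.one_mul, pow_succ' _ (m + 1),
          pow_succ' _ m, pow_two]
        noncomm_ring]
    simp only [Matrix.trace_add, Matrix.trace_sub]
    rw [Matrix.trace_mul_comm B (C * B ^ m), Matrix.trace_mul_comm C (B * C ^ m),
      Matrix.trace_mul_comm C (B ^ (m + 1)), Matrix.trace_mul_comm (C ^ 2),
      Matrix.mul_assoc C, Matrix.mul_assoc B, ← pow_succ, ← pow_succ,
      Matrix.trace_mul_comm C (B ^ (m + 1)), pow_one, pow_one]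
    ring
  rw [e1, e2]
  simp only [h, mul_sum, ← sum_add_distrib, ← sum_sub_distrib]
  refine sum_le_sum fun k _ => sum_le_sum fun l _ => ?_
  have := mul_le_mul_of_nonneg_right (sub_mul_pow_sub_pow_le (b := b k) (c := c l) hm) (hκ k l)
  refine le_of_eq_of_le ?_ (this.trans_eq ?_) <;> ring

lemma trace_mul_pow_le {Y S : Matrix W W ℝ} (hS : S.IsHermitian) {v : ℝ}
    (hY : (v • (1 : Matrix W W ℝ) - Y).PosSemidef) {m : ℕ} (hm : Even m) :
    (Y * S ^ m).trace ≤ v * (S ^ m).trace := by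
  -- With `m = 2h`, the difference of the two sides is the trace of `S^h (v - Y) S^h`, which is
  -- positive semidefinite.
  obtain ⟨h, rfl⟩ := hm
  have h1 := (hY.mul_mul_conjTranspose_same (S ^ h)).trace_nonneg
  rw [(hS.pow h).eq, Matrix.trace_mul_comm, ← Matrix.mul_assoc, ← pow_add, Matrix.mul_sub,
    Matrix.trace_sub, Matrix.mul_smul, Matrix.mul_one, Matrix.trace_smul,
    Matrix.trace_mul_comm _ Y, smul_eq_mul] at h1
  linarith

lemma trace_pow_nonneg {S : Matrix W W ℝ} (hS : S.IsHermitian) {m : ℕ} (hm : Even m) :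
    0 ≤ (S ^ m).trace := by
  obtain ⟨U, b, hU, -, hb⟩ := exists_diagonalization hS
  rw [trace_pow_eq_sum hU hb]
  exact sum_nonneg fun i _ => hm.pow_nonneg _

end Matrices

open Classical in
lemma opNorm_le_of_trace_pow_le {W : Type u} [Fintype W] {S : Matrix W W ℝ} (hS : S.IsHermitian)
    {m : ℕ} (hm : Even m) (hm0 : m ≠ 0) {t : ℝ} (ht : 0 ≤ t) (h : (S ^ m).trace ≤ t ^ m) :
    opNorm S ≤ t := by
  obtain ⟨U, b, hU, hU', hb⟩ := exists_diagonalization hS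
  rw [trace_pow_eq_sum hU hb] at h
  have hbt : ∀ i, |b i| ≤ t := fun i => by
    refine (pow_le_pow_iff_left₀ (abs_nonneg _) ht hm0).1 ?_
    rw [hm.pow_abs]
    exact (single_le_sum (f := fun i => b i ^ m) (fun i _ => hm.pow_nonneg _) (mem_univ i)).trans h
  unfold opNorm
  have hS1 : S = U * Matrix.diagonal b * U.transpose := by simpa using hb 1
  have hUmem : U ∈ unitary (Matrix W W ℝ) := by
    rw [Unitary.mem_iff]
    exact ⟨hU, hU'⟩
  have hmem : Matrix.toEuclideanCLM (n := W) (𝕜 := ℝ) U ∈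
      unitary (EuclideanSpace ℝ W →L[ℝ] EuclideanSpace ℝ W) := Unitary.map_mem _ hUmem
  have hstar : U.transpose = star U := rfl
  rw [hS1, hstar, map_mul, map_mul, map_star, CStarRing.norm_mul_mem_unitary _ (Unitary.star_mem hmem),
    CStarRing.norm_mem_unitary_mul _ hmem]
  open scoped Matrix.Norms.L2Operator in
  rw [← Matrix.cstar_norm_def, Matrix.l2_opNorm_diagonal]
  exact (pi_norm_le_iff_of_nonneg ht).2 hbt

/-! ### Moments of random matrices with exchangeable resampling -/

section Moments

variable {W Ω ι Γ : Type*} [Fintype W] [DecidableEq W] [Fintype Ω] [Fintype ι] [Fintype Γ]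

lemma sum_weighted_comp_equiv {p : Ω → ℝ} (θ : Ω ≃ Ω) (hp : ∀ ω, p (θ ω) = p ω) (f : Ω → ℝ) :
    ∑ ω, p ω * f (θ ω) = ∑ ω, p ω * f ω := by
  rw [← Equiv.sum_comp θ (fun ω => p ω * f ω)]
  simp only [hp]

/-- The contribution of one independent component to a moment of a random matrix `S`. The
component `X` is resampled by the measure-preserving maps `θ γ`, along which it has mean zero. -/
lemma sum_trace_mul_pow_le {p : Ω → ℝ} (hp : ∀ ω, 0 ≤ p ω) {S X : Ω → Matrix W W ℝ}
    (hS : ∀ ω, (S ω).IsHermitian) (θ : Γ → Ω ≃ Ω) (inv : Γ ≃ Γ)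
    (hinv : ∀ γ ω, θ (inv γ) (θ γ ω) = ω) (hpθ : ∀ γ ω, p (θ γ ω) = p ω)
    (havg : ∀ ω, p ω ≠ 0 → ∑ γ, X (θ γ ω) = 0)
    (hdiff : ∀ ω, p ω ≠ 0 → ∀ γ, S ω - S (θ γ ω) = X ω - X (θ γ ω)) {m : ℕ} (hm : Even m) :
    Fintype.card Γ * ∑ ω, p ω * (X ω * S ω ^ (m + 1)).trace
      ≤ (m + 1) / 2 * ∑ γ, ∑ ω, p ω * ((X ω - X (θ γ ω)) ^ 2 * S ω ^ m).trace := by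
  have key : ∀ f g : Ω → ℝ, (∀ ω, p ω ≠ 0 → f ω = g ω) → ∑ ω, p ω * f ω = ∑ ω, p ω * g ω := by
    intro f g h
    refine sum_congr rfl fun ω _ => ?_
    by_cases h0 : p ω = 0
    · simp [h0]
    · rw [h ω h0]
  have swap : ∀ F : Ω → Ω → ℝ,
      ∑ γ, ∑ ω, p ω * F (θ γ ω) ω = ∑ γ, ∑ ω, p ω * F ω (θ γ ω) := by
    intro F
    rw [← Equiv.sum_comp inv]
    refine sum_congr rfl fun γ _ => ?_
    rw [← sum_weighted_comp_equiv (θ γ) (hpθ γ)]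
    simp only [hinv]
  have a1 : Fintype.card Γ * ∑ ω, p ω * (X ω * S ω ^ (m + 1)).trace
      = ∑ γ, ∑ ω, p ω * ((X ω - X (θ γ ω)) * S ω ^ (m + 1)).trace := by
    rw [sum_comm]
    simp_rw [← mul_sum]
    calc Fintype.card Γ * ∑ ω, p ω * (X ω * S ω ^ (m + 1)).trace
        = ∑ ω, p ω * (Fintype.card Γ * (X ω * S ω ^ (m + 1)).trace) := by
          rw [mul_sum]
          exact sum_congr rfl fun ω _ => by ring
      _ = _ := key _ _ fun ω h0 => by
          -- Only `X` is resampled here and `S ω` stays fixed, so the mean-zero condition lets `X`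
          -- be replaced by `X - X'` at no cost.
          have : ∑ γ, (X (θ γ ω) * S ω ^ (m + 1)).trace = 0 := by
            rw [← Matrix.trace_sum, ← Matrix.sum_mul, havg ω h0]
            simp
          simp_rw [Matrix.sub_mul, Matrix.trace_sub]
          rw [sum_sub_distrib, this]
          simp
  have a2 := swap fun ω' ω => ((X ω - X ω') * S ω ^ (m + 1)).trace
  have a3 := swap fun ω' ω => ((X ω - X ω') ^ 2 * S ω ^ m).trace
  have a4 : ∑ γ, ∑ ω, p ω * ((S ω - S (θ γ ω)) * (S ω ^ (m + 1) - S (θ γ ω) ^ (m + 1))).trace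
      = 2 * ∑ γ, ∑ ω, p ω * ((X ω - X (θ γ ω)) * S ω ^ (m + 1)).trace := by
    rw [two_mul]
    -- Exchangeability: in one of two equal copies `ω` and `θ γ ω` trade places. The first factor
    -- changes sign, so the copies add up to a difference of the powers.
    nth_rewrite 2 [a2]
    rw [← sum_add_distrib]
    refine sum_congr rfl fun γ _ => ?_
    rw [← sum_add_distrib]
    simp_rw [← mul_add]
    refine key _ _ fun ω h0 => ?_
    rw [hdiff ω h0, Matrix.mul_sub, Matrix.trace_sub, Matrix.sub_mul (X (θ γ ω)),
      Matrix.sub_mul (X ω), Matrix.sub_mul (X ω)]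
    simp only [Matrix.trace_sub]
    ring
  have a5 : ∑ γ, ∑ ω, p ω * ((S ω - S (θ γ ω)) ^ 2 * (S ω ^ m + S (θ γ ω) ^ m)).trace
      = 2 * ∑ γ, ∑ ω, p ω * ((X ω - X (θ γ ω)) ^ 2 * S ω ^ m).trace := by
    rw [two_mul]
    nth_rewrite 2 [a3]
    rw [← sum_add_distrib]
    refine sum_congr rfl fun γ _ => ?_
    rw [← sum_add_distrib]
    simp_rw [← mul_add]
    refine key _ _ fun ω h0 => ?_
    rw [hdiff ω h0, Matrix.mul_add, Matrix.trace_add, ← neg_sub (X ω), neg_sq]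
  have a6 : ∑ γ, ∑ ω, p ω * ((S ω - S (θ γ ω)) * (S ω ^ (m + 1) - S (θ γ ω) ^ (m + 1))).trace
      ≤ (m + 1) / 2 *
        ∑ γ, ∑ ω, p ω * ((S ω - S (θ γ ω)) ^ 2 * (S ω ^ m + S (θ γ ω) ^ m)).trace := by
    simp only [mul_sum]
    refine sum_le_sum fun γ _ => sum_le_sum fun ω _ => ?_
    rw [mul_left_comm]
    exact mul_le_mul_of_nonneg_left (trace_sub_mul_pow_sub_pow_le (hS _) (hS _) hm) (hp ω)
  rw [a4, a5] at a6
  rw [a1]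
  linarith

/-- The factor `r` allows the components to be indexed redundantly: it is `1/2` for edges listed as
ordered pairs. -/
lemma sum_trace_pow_step {p : Ω → ℝ} (hp : ∀ ω, 0 ≤ p ω) {S : Ω → Matrix W W ℝ}
    {X : ι → Ω → Matrix W W ℝ} (hS : ∀ ω, (S ω).IsHermitian) {r : ℝ} (hr : 0 ≤ r)
    (hSX : ∀ ω, p ω ≠ 0 → S ω = r • ∑ i, X i ω) (θ : ι → Γ → Ω ≃ Ω) (inv : Γ ≃ Γ) [Nonempty Γ]
    (hinv : ∀ i γ ω, θ i (inv γ) (θ i γ ω) = ω) (hpθ : ∀ i γ ω, p (θ i γ ω) = p ω)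
    (havg : ∀ i ω, p ω ≠ 0 → ∑ γ, X i (θ i γ ω) = 0)
    (hdiff : ∀ i ω, p ω ≠ 0 → ∀ γ, S ω - S (θ i γ ω) = X i ω - X i (θ i γ ω)) {v : ℝ}
    (hvar : ∀ ω, p ω ≠ 0 → ∀ γ, (v • (1 : Matrix W W ℝ)
      - r • ∑ i, (X i ω - X i (θ i γ ω)) ^ 2).PosSemidef) {m : ℕ} (hm : Even m) :
    ∑ ω, p ω * (S ω ^ (m + 2)).trace ≤ v * ((m + 1) / 2) * ∑ ω, p ω * (S ω ^ m).trace := by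
  have hΓ : (0 : ℝ) < Fintype.card Γ := by exact_mod_cast Fintype.card_pos
  have h1 : ∑ ω, p ω * (S ω ^ (m + 2)).trace
      = r * ∑ i, ∑ ω, p ω * (X i ω * S ω ^ (m + 1)).trace := by
    rw [sum_comm, mul_sum]
    refine sum_congr rfl fun ω _ => ?_
    by_cases h0 : p ω = 0
    · simp [h0]
    · rw [← mul_sum, ← Matrix.trace_sum, ← Matrix.sum_mul, mul_left_comm, ← smul_eq_mul r,
        ← Matrix.trace_smul, ← Matrix.smul_mul, ← hSX ω h0, ← pow_succ']
  have h2 : ∀ γ, r * ∑ i, ∑ ω, p ω * ((X i ω - X i (θ i γ ω)) ^ 2 * S ω ^ m).trace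
      ≤ v * ∑ ω, p ω * (S ω ^ m).trace := by
    intro γ
    rw [sum_comm, mul_sum, mul_sum]
    refine sum_le_sum fun ω _ => ?_
    by_cases h0 : p ω = 0
    · simp [h0]
    · rw [← mul_sum, ← Matrix.trace_sum, ← Matrix.sum_mul, mul_left_comm, ← smul_eq_mul r,
        ← Matrix.trace_smul, ← Matrix.smul_mul, mul_left_comm v]
      exact mul_le_mul_of_nonneg_left (trace_mul_pow_le (hS ω) (hvar ω h0 γ) hm) (hp ω)
  have h3 : Fintype.card Γ * ∑ ω, p ω * (S ω ^ (m + 2)).trace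
      ≤ (m + 1) / 2 * ∑ γ, r * ∑ i, ∑ ω, p ω * ((X i ω - X i (θ i γ ω)) ^ 2 * S ω ^ m).trace := by
    rw [h1, ← mul_sum, mul_left_comm, mul_left_comm _ r,
      sum_comm (s := (univ : Finset Γ)) (t := (univ : Finset ι))]
    refine mul_le_mul_of_nonneg_left ?_ hr
    rw [mul_sum, mul_sum]
    exact sum_le_sum fun i _ => sum_trace_mul_pow_le hp hS (θ i) inv (hinv i) (hpθ i) (havg i)
      (hdiff i) hm
  have h4 : ∑ γ : Γ, r * ∑ i, ∑ ω, p ω * ((X i ω - X i (θ i γ ω)) ^ 2 * S ω ^ m).trace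
      ≤ Fintype.card Γ * (v * ∑ ω, p ω * (S ω ^ m).trace) := by
    refine (sum_le_sum fun γ _ => h2 γ).trans_eq ?_
    simp
  have h5 : (0 : ℝ) ≤ (m + 1) / 2 := by positivity
  refine le_of_mul_le_mul_left (h3.trans ((mul_le_mul_of_nonneg_left h4 h5).trans_eq ?_)) hΓ
  ring

/-- The bound `P` keeps the factor of every step the same during the induction, since `(2n + 1)/2 ≤
P` whenever `n + 1 ≤ P`. -/
lemma sum_trace_pow_le {p : Ω → ℝ} (hp : ∀ ω, 0 ≤ p ω) (hp1 : ∑ ω, p ω = 1)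
    {S : Ω → Matrix W W ℝ} (hS : ∀ ω, (S ω).IsHermitian) {v : ℝ} (hv : 0 ≤ v)
    (h : ∀ m : ℕ, Even m →
      ∑ ω, p ω * (S ω ^ (m + 2)).trace ≤ v * ((m + 1) / 2) * ∑ ω, p ω * (S ω ^ m).trace)
    (n P : ℕ) (hn : n ≤ P) :
    ∑ ω, p ω * (S ω ^ (2 * n)).trace ≤ (v * P) ^ n * Fintype.card W := by
  induction n with
  | zero => simp [← sum_mul, hp1]
  | succ n ih =>
    have hev : Even (2 * n) := even_two_mul n
    have h1 := h (2 * n) hev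
    have h2 : ((2 * n : ℕ) + 1 : ℝ) / 2 ≤ P := by
      have : ((n + 1 : ℕ) : ℝ) ≤ P := by exact_mod_cast hn
      push_cast at this ⊢
      linarith
    have h0 : 0 ≤ ∑ ω, p ω * (S ω ^ (2 * n)).trace :=
      sum_nonneg fun ω _ => mul_nonneg (hp ω) (trace_pow_nonneg (hS ω) hev)
    rw [show 2 * (n + 1) = 2 * n + 2 by ring]
    calc _ ≤ _ := h1
      _ ≤ v * P * ∑ ω, p ω * (S ω ^ (2 * n)).trace := by gcongr
      _ ≤ v * P * ((v * P) ^ n * Fintype.card W) := by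
          have := ih (by omega)
          gcongr
      _ = _ := by ring

end Moments

end GraphLift

namespace GraphLift

/-! ### Covers and their twists -/

section Covers

variable {V W W' : Type*}

/-- `H` covers `G` along `π`: adjacent vertices lie over adjacent vertices, and every edge at `π x`
has exactly one lift at `x`. -/
def IsCover (π : W → V) (G : SimpleGraph V) (H : SimpleGraph W) : Prop :=
  (∀ x y, H.Adj x y → G.Adj (π x) (π y)) ∧
    ∀ x w, G.Adj (π x) w → ∃! y, π y = w ∧ H.Adj x y

lemma perm_apply_inv (τ : Equiv.Perm W) (x : W) : τ (τ⁻¹ x) = x :=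
  Equiv.Perm.eq_inv_iff_eq.1 rfl

lemma isCover_id (G : SimpleGraph V) : IsCover id G G :=
  ⟨fun _ _ h => h, fun _ w h => ⟨w, ⟨rfl, h⟩, fun _ hy => hy.1⟩⟩

lemma IsCover.comp {π : W → V} {q : W' → W} {G : SimpleGraph V} {H : SimpleGraph W}
    {K : SimpleGraph W'} (hH : IsCover π G H) (hK : IsCover q H K) : IsCover (π ∘ q) G K := by
  refine ⟨fun x y h => hH.1 _ _ (hK.1 _ _ h), fun x w h => ?_⟩
  obtain ⟨z, ⟨hz, hxz⟩, hz'⟩ := hH.2 (q x) w h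
  obtain ⟨y, ⟨hy, hxy⟩, hy'⟩ := hK.2 x z hxz
  refine ⟨y, ⟨by simp [hy, hz], hxy⟩, fun y₁ ⟨h1, h2⟩ => hy' y₁ ⟨?_, h2⟩⟩
  exact hz' _ ⟨h1, hK.1 _ _ h2⟩

open Classical in
/-- The endpoint `x` of a pair `x, y`, moved by `τ⁻¹` if it lies over `w` while `y` lies over
`v`. -/
def twistVertex (π : W → V) (v w : V) (τ : Equiv.Perm W) (x y : W) : W :=
  if π x = w ∧ π y = v then τ⁻¹ x else x

/-- The graph obtained from `H` by applying `τ` to those endpoints over `w` of the edges between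
the fibres of `v` and `w`. -/
def twist (π : W → V) (v w : V) (τ : Equiv.Perm W) (H : SimpleGraph W) : SimpleGraph W where
  Adj x y := H.Adj (twistVertex π v w τ x y) (twistVertex π v w τ y x)
  symm := ⟨fun _ _ h => h.symm⟩
  loopless := ⟨fun _ h => H.irrefl h⟩

lemma twist_adj {π : W → V} {v w : V} {τ : Equiv.Perm W} {H : SimpleGraph W} {x y : W} :
    (twist π v w τ H).Adj x y ↔
      H.Adj (twistVertex π v w τ x y) (twistVertex π v w τ y x) := Iff.rfl

lemma proj_inv {π : W → V} {τ : Equiv.Perm W} (hτ : ∀ x, π (τ x) = π x) (x : W) :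
    π (τ⁻¹ x) = π x := by
  rw [← hτ, perm_apply_inv]

lemma proj_twistVertex {π : W → V} {τ : Equiv.Perm W} (hτ : ∀ x, π (τ x) = π x) (v w : V)
    (x y : W) : π (twistVertex π v w τ x y) = π x := by
  unfold twistVertex
  split_ifs
  · exact proj_inv hτ x
  · rfl

lemma twist_one (π : W → V) (v w : V) (H : SimpleGraph W) : twist π v w 1 H = H := by
  ext x y
  simp [twist_adj, twistVertex]

lemma twist_twist {π : W → V} {τ : Equiv.Perm W} (hτ : ∀ x, π (τ x) = π x) (v w : V)
    (σ : Equiv.Perm W) (H : SimpleGraph W) :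
    twist π v w τ (twist π v w σ H) = twist π v w (τ * σ) H := by
  have key : ∀ x y, twistVertex π v w σ (twistVertex π v w τ x y) (twistVertex π v w τ y x)
      = twistVertex π v w (τ * σ) x y := by
    intro x y
    have h1 := proj_twistVertex hτ v w x y
    have h2 := proj_twistVertex hτ v w y x
    by_cases h : π x = w ∧ π y = v
    · rw [twistVertex, h1, h2, if_pos h, twistVertex, if_pos h, twistVertex, if_pos h, mul_inv_rev]
      rfl
    · rw [twistVertex, h1, h2, if_neg h, twistVertex, if_neg h, twistVertex, if_neg h]
  ext x y
  simp only [twist_adj, key]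

/-- Twisting as a permutation of the set of graphs. -/
def twistEquiv (π : W → V) (v w : V) (τ : Equiv.Perm W) (hτ : ∀ x, π (τ x) = π x) :
    SimpleGraph W ≃ SimpleGraph W where
  toFun := twist π v w τ
  invFun := twist π v w τ⁻¹
  left_inv H := by rw [twist_twist (proj_inv hτ), inv_mul_cancel, twist_one]
  right_inv H := by rw [twist_twist hτ, mul_inv_cancel, twist_one]

lemma IsCover.map_twist {π : W → V} {q : W' → W} {G : SimpleGraph W} {H : SimpleGraph W'}
    (hH : IsCover q G H) {τ : Equiv.Perm W} {σ : Equiv.Perm W'} (hσ : ∀ x, q (σ x) = τ (q x))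
    (v w : V) : IsCover q (twist π v w τ G) (twist (π ∘ q) v w σ H) := by
  have hσ' : ∀ x, q (σ⁻¹ x) = τ⁻¹ (q x) := fun x => by
    rw [Equiv.Perm.eq_inv_iff_eq, ← hσ, perm_apply_inv]
  have hq : ∀ x y, q (twistVertex (π ∘ q) v w σ x y) = twistVertex π v w τ (q x) (q y) := by
    intro x y
    by_cases h : π (q x) = w ∧ π (q y) = v
    · simp only [twistVertex, Function.comp_apply, if_pos h, hσ']
    · simp only [twistVertex, Function.comp_apply, if_neg h]
  refine ⟨fun x y h => ?_, fun x z h => ?_⟩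
  · rw [twist_adj, ← hq, ← hq]
    exact hH.1 _ _ h
  · classical
    rw [twist_adj] at h
    -- For every `y` over `z`, adjacency of `x` and `y` in the twist is adjacency of `x'` and `g y`
    -- in `H`, and `g` carries the fibre of `z` onto that of `z'`. So unique lifting at `x` over `z`
    -- is unique lifting at `x'` over `z'`.
    let x' := if π (q x) = w ∧ π z = v then σ⁻¹ x else x
    let g : Equiv.Perm W' := if π z = w ∧ π (q x) = v then σ⁻¹ else 1
    let z' := twistVertex π v w τ z (q x)
    have hx' : q x' = twistVertex π v w τ (q x) z := by
      by_cases h : π (q x) = w ∧ π z = v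
      · simp only [x', if_pos h, twistVertex, hσ']
      · simp only [x', if_neg h, twistVertex]
    have hx : ∀ y, q y = z → twistVertex (π ∘ q) v w σ x y = x' := by
      rintro y rfl
      rfl
    have hy : ∀ y, q y = z → twistVertex (π ∘ q) v w σ y x = g y := by
      rintro y rfl
      by_cases h : π (q y) = w ∧ π (q x) = v
      · simp only [twistVertex, Function.comp_apply, g, if_pos h]
      · simp only [twistVertex, Function.comp_apply, g, if_neg h, Equiv.Perm.one_apply]
    have hg : ∀ y, q (g y) = z' ↔ q y = z := by
      intro y
      by_cases h : π z = w ∧ π (q x) = v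
      · simp only [g, z', twistVertex, if_pos h, hσ', EmbeddingLike.apply_eq_iff_eq]
      · simp only [g, z', twistVertex, if_neg h, Equiv.Perm.one_apply]
    rw [← hx'] at h
    obtain ⟨y, ⟨hy1, hy2⟩, hy3⟩ := hH.2 x' z' h
    have hyz : q (g⁻¹ y) = z := by rw [← hg, perm_apply_inv, hy1]
    refine ⟨g⁻¹ y, ⟨hyz, ?_⟩, fun y₁ ⟨h1, h2⟩ => ?_⟩
    · rw [twist_adj, hx _ hyz, hy _ hyz, perm_apply_inv]
      exact hy2
    · rw [twist_adj, hx _ h1, hy _ h1] at h2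
      rw [Equiv.Perm.eq_inv_iff_eq]
      exact hy3 _ ⟨(hg y₁).2 h1, h2⟩

lemma isCover_twist_iff {π : W → V} {q : W' → W} {G : SimpleGraph W} {H : SimpleGraph W'}
    {τ : Equiv.Perm W} {σ : Equiv.Perm W'} (hτ : ∀ x, π (τ x) = π x)
    (hσ : ∀ x, q (σ x) = τ (q x)) (v w : V) :
    IsCover q (twist π v w τ G) (twist (π ∘ q) v w σ H) ↔ IsCover q G H := by
  refine ⟨fun h => ?_, fun h => h.map_twist hσ v w⟩
  have hσ' : ∀ x, q (σ⁻¹ x) = τ⁻¹ (q x) := fun x => by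
    rw [Equiv.Perm.eq_inv_iff_eq, ← hσ, perm_apply_inv]
  have h1 := h.map_twist (π := π) hσ' v w
  have h2 : ∀ x, (π ∘ q) (σ x) = (π ∘ q) x := fun x => by simp [hσ, hτ]
  rwa [twist_twist (proj_inv hτ), twist_twist (proj_inv h2), inv_mul_cancel, inv_mul_cancel,
    twist_one, twist_one] at h1

end Covers

/-! ### Lifts are covers -/

section Lifts

variable {V : Type u} {G : SimpleGraph V} {k : ℕ}

lemma eq_of_mem_edgeMatching {e : Sym2 V} (M : EdgeMatching k e) {x y : V × Fin k}
    (h : s(x, y) ∈ M.1) : e = s(x.1, y.1) := by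
  induction e using Sym2.ind with
  | _ v w =>
    obtain ⟨f, hf⟩ := M.2 v w rfl
    rw [hf] at h
    obtain ⟨a, ha⟩ := h
    have h1 : (a : V × Fin k).1 = v := a.2
    have h2 : (f a : V × Fin k).1 = w := (f a).2
    have h3 := congrArg (Sym2.map Prod.fst) ha
    rw [← h1, ← h2]
    exact h3

lemma lift_adj (M : MatchingFamily G k) {x y : V × Fin k} :
    (lift M).Adj x y ↔ ∃ h : G.Adj x.1 y.1, s(x, y) ∈ (M ⟨s(x.1, y.1), h⟩).1 := by
  rw [lift, SimpleGraph.fromEdgeSet_adj, Set.mem_iUnion]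
  constructor
  · rintro ⟨⟨⟨e, he⟩, h⟩, -⟩
    obtain rfl := eq_of_mem_edgeMatching _ h
    exact ⟨he, h⟩
  · rintro ⟨h, hM⟩
    exact ⟨⟨_, hM⟩, fun hxy => h.ne (congrArg Prod.fst hxy)⟩

lemma lift_injective : Function.Injective (lift : MatchingFamily G k → _) := by
  have key : ∀ M N : MatchingFamily G k, lift M = lift N → ∀ e z, z ∈ (M e).1 → z ∈ (N e).1 := by
    intro M N h e z
    induction z using Sym2.ind with
    | _ x y =>
      intro hz
      obtain ⟨e, he⟩ := e
      obtain rfl := eq_of_mem_edgeMatching _ hz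
      have h1 : (lift M).Adj x y := (lift_adj M).2 ⟨he, hz⟩
      rw [h] at h1
      exact ((lift_adj N).1 h1).2
  intro M N h
  funext e
  exact Subtype.ext (Set.Subset.antisymm (key M N h e) (key N M h.symm e))

lemma isCover_lift (M : MatchingFamily G k) : IsCover Prod.fst G (lift M) := by
  refine ⟨fun x y h => ((lift_adj M).1 h).1, fun x w h => ?_⟩
  obtain ⟨f, hf⟩ := (M ⟨s(x.1, w), h⟩).2 x.1 w rfl
  have hw : (f ⟨x, rfl⟩ : V × Fin k).1 = w := (f ⟨x, rfl⟩).2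
  refine ⟨f ⟨x, rfl⟩, ⟨hw, ?_⟩, ?_⟩
  · rw [lift_adj]
    generalize hz : (f ⟨x, rfl⟩ : V × Fin k) = z at hw
    subst hw
    refine ⟨h, ?_⟩
    rw [hf]
    exact ⟨⟨x, rfl⟩, by simp only [hz]⟩
  · rintro y ⟨rfl, hy⟩
    obtain ⟨a, ha⟩ := hf.subset ((lift_adj M).1 hy).2
    rcases Sym2.eq_iff.1 ha with ⟨h1, h2⟩ | ⟨h1, h2⟩
    · have h3 : a = ⟨x, rfl⟩ := Subtype.ext h1
      exact h2.symm.trans (by rw [h3])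
    · have h3 : (a : V × Fin k).1 = x.1 := a.2
      rw [h1] at h3
      exact absurd h3 h.ne'

lemma IsCover.isMatchingOf {H : SimpleGraph (V × Fin k)} (hH : IsCover Prod.fst G H) {v w : V}
    (h : G.Adj v w) :
    IsMatchingOf (fibre k v) (fibre k w) {z | z ∈ H.edgeSet ∧ z.map Prod.fst = s(v, w)} := by
  have h1 : ∀ x : fibre k v, ∃! y, Prod.fst y = w ∧ H.Adj x y := fun x =>
    hH.2 x w (by rw [show (x : V × Fin k).1 = v from x.2]; exact h)
  have h2 : ∀ y : fibre k w, ∃! x, Prod.fst x = v ∧ H.Adj y x := fun y =>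
    hH.2 y v (by rw [show (y : V × Fin k).1 = w from y.2]; exact h.symm)
  choose f hf hf' using h1
  choose g hg hg' using h2
  refine ⟨⟨fun x => ⟨f x, (hf x).1⟩, fun y => ⟨g y, (hg y).1⟩, fun x => ?_, fun y => ?_⟩, ?_⟩
  · exact Subtype.ext (hg' _ x ⟨x.2, (hf x).2.symm⟩).symm
  · exact Subtype.ext (hf' _ y ⟨y.2, (hg y).2.symm⟩).symm
  · ext z
    induction z using Sym2.ind with
    | _ x y =>
      constructor
      · rintro ⟨h3, h4⟩
        rw [Sym2.map_mk] at h4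
        rcases Sym2.eq_iff.1 h4 with ⟨rfl, rfl⟩ | ⟨rfl, rfl⟩
        · exact ⟨⟨x, rfl⟩, by simp [← hf' ⟨x, rfl⟩ y ⟨rfl, h3⟩]⟩
        · exact ⟨⟨y, rfl⟩, by simp [← hf' ⟨y, rfl⟩ x ⟨rfl, h3.symm⟩, Sym2.eq_swap]⟩
      · rintro ⟨a, ha⟩
        simp only [Equiv.coe_fn_mk] at ha
        rw [← ha]
        refine ⟨(hf a).2, ?_⟩
        rw [Sym2.map_mk, (hf a).1, show (a : V × Fin k).1 = v from a.2]

/-- Together with `lift_injective`, this makes the random lift uniform on the covers of `G` along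
the first projection, so any bijection between sets of such covers transports its law. -/
lemma range_lift : Set.range (lift : MatchingFamily G k → _) = {H | IsCover Prod.fst G H} := by
  ext H
  constructor
  · rintro ⟨M, rfl⟩
    exact isCover_lift M
  · intro hH
    refine ⟨fun e => ⟨{z | z ∈ H.edgeSet ∧ z.map Prod.fst = e}, ?_⟩, ?_⟩
    · intro v w hvw
      have h := e.2
      rw [hvw] at h ⊢
      exact IsCover.isMatchingOf hH h
    · ext x y
      exact (lift_adj _).trans ⟨fun h => h.2.1, fun h => ⟨hH.1 _ _ h, h, rfl⟩⟩

lemma map_uniformOfFintype {α β : Type*} [Fintype α] [Nonempty α] [Fintype β] [Nonempty β]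
    (e : α ≃ β) : (PMF.uniformOfFintype α).map e = PMF.uniformOfFintype β := by
  classical
  ext b
  rw [PMF.map_apply, tsum_eq_single (e.symm b)]
  · simp [Fintype.card_congr e]
  · intro a ha
    rw [if_neg]
    rintro rfl
    simp at ha

variable [Finite V]

lemma isCover_of_mem_support_randomLift {H : SimpleGraph (V × Fin k)}
    (h : H ∈ (randomLift G k).support) : IsCover Prod.fst G H := by
  rw [randomLift, PMF.mem_support_map_iff] at h
  obtain ⟨M, -, rfl⟩ := h
  exact isCover_lift M

/-- Twisting by `σ` is a bijection from the covers of `G` to the covers of the twisted graph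
(`isCover_twist_iff`), and bijections preserve uniform laws. -/
lemma randomLift_twist {V₀ : Type*} {π : V → V₀} (v w : V₀) {τ : Equiv.Perm V}
    (hτ : ∀ x, π (τ x) = π x) {σ : Equiv.Perm (V × Fin k)} (hσ : ∀ x, (σ x).1 = τ x.1) :
    randomLift (twist π v w τ G) k = (randomLift G k).map (twist (π ∘ Prod.fst) v w σ) := by
  have h2 : ∀ x, (π ∘ Prod.fst) (σ x) = (π ∘ Prod.fst) x := fun x => by simp [hσ, hτ]
  let e₀ : Set.range (lift : MatchingFamily G k → _) ≃
      Set.range (lift : MatchingFamily (twist π v w τ G) k → _) :=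
    (twistEquiv (π ∘ Prod.fst) v w σ h2).subtypeEquiv fun H => by
      rw [range_lift, range_lift]
      exact (isCover_twist_iff hτ hσ v w).symm
  let e : MatchingFamily G k ≃ MatchingFamily (twist π v w τ G) k :=
    ((Equiv.ofInjective lift lift_injective).trans e₀).trans
      (Equiv.ofInjective lift lift_injective).symm
  have he : lift ∘ e = twist (π ∘ Prod.fst) v w σ ∘ (lift : MatchingFamily G k → _) := by
    funext M
    have : (Equiv.ofInjective lift lift_injective) (e M)
        = e₀ (Equiv.ofInjective lift lift_injective M) := by simp [e]
    exact congrArg Subtype.val this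
  rw [randomLift, randomLift, PMF.map_comp, ← he, ← PMF.map_comp, map_uniformOfFintype]

end Lifts

/-! ### Iterated lifts -/

/-- The projection of an iterated lift of `W`, followed by `π`. -/
def iterProj {V : Type*} : (ks : List ℕ) → {W : Type u} → (W → V) → IterVertex W ks → V
  | [], _, π => π
  | _ :: ks, _, π => iterProj ks (π ∘ Prod.fst)

lemma iterProj_comp {V V' : Type*} (f : V → V') (ks : List ℕ) {W : Type u} (π : W → V)
    (x : IterVertex W ks) : iterProj ks (f ∘ π) x = f (iterProj ks π x) := by
  induction ks generalizing W with
  | nil => rfl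
  | cons k ks ih => exact ih (π ∘ Prod.fst) x

lemma iterProj_eq {V : Type*} (ks : List ℕ) {W : Type u} (π : W → V) (x : IterVertex W ks) :
    iterProj ks π x = π (iterProj ks id x) :=
  iterProj_comp π ks id x

/-- The rotation of `Fin k` by `a`. -/
def rotate {k : ℕ} (a : Fin k) : Equiv.Perm (Fin k) :=
  haveI : NeZero k := ⟨(Fin.pos a).ne'⟩
  Equiv.addRight a

/-- The negation of `Fin k`. -/
def rotateNeg : {k : ℕ} → Equiv.Perm (Fin k)
  | 0 => 1
  | _ + 1 => Equiv.neg _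

lemma rotate_rotateNeg {k : ℕ} (a : Fin k) : rotate (rotateNeg a) = (rotate a)⁻¹ := by
  cases k with
  | zero => exact a.elim0
  | succ k =>
    ext i
    simp [rotate, rotateNeg, Equiv.Perm.inv_def]

lemma existsUnique_rotate {k : ℕ} (i j : Fin k) : ∃! a, rotate a i = j := by
  cases k with
  | zero => exact i.elim0
  | succ k =>
    refine ⟨j - i, by simp [rotate], fun a ha => ?_⟩
    rw [← ha]
    simp [rotate]

/-- Tuples of rotations, one for every level of an iterated lift. -/
def IterShift : List ℕ → Type
  | [] => Unit
  | k :: ks => Fin k × IterShift ks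

instance iterShiftFinite : (ks : List ℕ) → Finite (IterShift ks)
  | [] => inferInstanceAs (Finite Unit)
  | k :: ks => haveI := iterShiftFinite ks; inferInstanceAs (Finite (Fin k × IterShift ks))

/-- The inversion of a tuple of rotations. -/
def iterNeg : (ks : List ℕ) → Equiv.Perm (IterShift ks)
  | [] => 1
  | _ :: ks => Equiv.prodCongr rotateNeg (iterNeg ks)

/-- The permutation of the vertices of an iterated lift which acts by `τ` on the bottom level and
by the rotations `a` on the further levels. -/
def iterPerm : (ks : List ℕ) → {W : Type u} → Equiv.Perm W → IterShift ks →
    Equiv.Perm (IterVertex W ks)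
  | [], _, τ, _ => τ
  | _ :: ks, _, τ, a => iterPerm ks (Equiv.prodCongr τ (rotate a.1)) a.2

lemma iterPerm_iterNeg (ks : List ℕ) {W : Type u} (τ : Equiv.Perm W) (a : IterShift ks) :
    iterPerm ks τ⁻¹ (iterNeg ks a) = (iterPerm ks τ a)⁻¹ := by
  induction ks generalizing W with
  | nil => rfl
  | cons k ks ih =>
    have h : (Equiv.prodCongr τ⁻¹ (rotate (rotateNeg a.1)) : Equiv.Perm (W × Fin k))
        = (Equiv.prodCongr τ (rotate a.1) : Equiv.Perm (W × Fin k))⁻¹ := by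
      rw [rotate_rotateNeg]
      rfl
    have := ih (Equiv.prodCongr τ (rotate a.1)) a.2
    rw [← h] at this
    exact this

lemma iterProj_iterPerm (ks : List ℕ) {W : Type u} (τ : Equiv.Perm W) (a : IterShift ks)
    (x : IterVertex W ks) : iterProj ks id (iterPerm ks τ a x) = τ (iterProj ks id x) := by
  induction ks generalizing W with
  | nil => rfl
  | cons k ks ih =>
    obtain ⟨a, b⟩ := a
    have key : ∀ x : IterVertex (W × Fin k) ks,
        iterProj ks (id ∘ Prod.fst) (iterPerm ks (Equiv.prodCongr τ (rotate a)) b x)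
          = τ (iterProj ks (id ∘ Prod.fst) x) := fun x => by
      rw [iterProj_eq, iterProj_eq ks (id ∘ Prod.fst) x, ih]
      rfl
    exact key x

/-- At each level exactly one rotation matches the coordinate of `x` with that of `y`, so the tuple
is found level by level. A general `τ` is needed because the permutation of the lower levels becomes
the base of the next one. -/
lemma existsUnique_iterPerm (ks : List ℕ) {W : Type u} (τ : Equiv.Perm W)
    {x y : IterVertex W ks} (h : iterProj ks id y = τ (iterProj ks id x)) :
    ∃! a, iterPerm ks τ a x = y := by
  induction ks generalizing W with
  | nil => exact ⟨(), h.symm, fun _ _ => rfl⟩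
  | cons k ks ih =>
    have key : ∀ x y : IterVertex (W × Fin k) ks,
        iterProj ks (id ∘ Prod.fst) y = τ (iterProj ks (id ∘ Prod.fst) x) →
        ∃! a : Fin k × IterShift ks,
          iterPerm ks (Equiv.prodCongr τ (rotate a.1)) a.2 x = y := by
      intro x y h
      rw [iterProj_eq, iterProj_eq ks (id ∘ Prod.fst) x] at h
      obtain ⟨a, ha, ha'⟩ := existsUnique_rotate (iterProj ks id x).2 (iterProj ks id y).2
      obtain ⟨b, hb, hb'⟩ := ih (Equiv.prodCongr τ (rotate a)) (x := x) (y := y)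
        (Prod.ext h ha.symm)
      refine ⟨(a, b), hb, ?_⟩
      rintro ⟨a', b'⟩ h'
      have h1 := iterProj_iterPerm ks (Equiv.prodCongr τ (rotate a')) b' x
      rw [h'] at h1
      obtain rfl := ha' a' (congrArg Prod.snd h1).symm
      rw [hb' b' h']
    exact key x y h

lemma isCover_of_mem_support_iteratedLift (ks : List ℕ) {V : Type u} [Finite V]
    {G : SimpleGraph V} {H : SimpleGraph (IterVertex V ks)}
    (h : H ∈ (iteratedLift ks G).support) : IsCover (iterProj ks id) G H := by
  induction ks generalizing V with
  | nil =>
    obtain rfl : H = G := (PMF.mem_support_pure_iff _ _).1 h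
    exact isCover_id H
  | cons k ks ih =>
    have key : ∀ H : SimpleGraph (IterVertex (V × Fin k) ks),
        H ∈ ((randomLift G k).bind fun K => iteratedLift ks K).support →
        IsCover (iterProj ks (id ∘ Prod.fst)) G H := by
      intro H h
      obtain ⟨K, hK, hH⟩ := (PMF.mem_support_bind_iff _ _ _).1 h
      have h1 := (isCover_of_mem_support_randomLift hK).comp (ih hH)
      have h2 : (Prod.fst ∘ iterProj ks id : IterVertex (V × Fin k) ks → V)
          = iterProj ks (id ∘ Prod.fst) := by
        funext x
        exact (iterProj_eq ks (id ∘ Prod.fst) x).symm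
      rwa [h2] at h1
    exact key H h

/-- The base graph is twisted as well, so that the induction passes through the levels: after one
lift, the product of `τ` and a rotation plays the role of `τ`. -/
lemma iteratedLift_twist {V₀ : Type*} (ks : List ℕ) {V : Type u} [Finite V] (G : SimpleGraph V)
    {π : V → V₀} (v w : V₀) {τ : Equiv.Perm V} (hτ : ∀ x, π (τ x) = π x) (a : IterShift ks) :
    iteratedLift ks (twist π v w τ G)
      = (iteratedLift ks G).map (twist (iterProj ks π) v w (iterPerm ks τ a)) := by
  induction ks generalizing V with
  | nil => exact (PMF.pure_map _ _).symm
  | cons k ks ih =>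
    change (randomLift (twist π v w τ G) k).bind (fun K => iteratedLift ks K) =
      ((randomLift G k).bind fun K => iteratedLift ks K).map
        (twist (iterProj ks (π ∘ Prod.fst)) v w
          (iterPerm ks (Equiv.prodCongr τ (rotate a.1)) a.2))
    rw [randomLift_twist v w hτ (σ := Equiv.prodCongr τ (rotate a.1)) (fun x => rfl),
      PMF.bind_map, PMF.map_bind]
    congr 1
    funext K
    exact ih K (π := π ∘ Prod.fst) (τ := Equiv.prodCongr τ (rotate a.1)) (fun x => hτ x.1) a.2

/-- The law of an iterated lift of `G` does not change if the part over an edge of `G` is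
twisted. -/
lemma iteratedLift_map_twist (ks : List ℕ) {V : Type u} [Finite V] (G : SimpleGraph V) (v w : V)
    (a : IterShift ks) :
    (iteratedLift ks G).map (twist (iterProj ks id) v w (iterPerm ks 1 a))
      = iteratedLift ks G := by
  rw [← iteratedLift_twist ks G v w (fun _ => rfl) a, twist_one]

/-- The identification of the vertex set of an iterated lift with the vertex set of a lift. -/
def iterEquiv : (ks : List ℕ) → (V : Type u) → IterVertex V ks ≃ V × Fin ks.prod
  | [], V => (Equiv.prodUnique V (Fin 1)).symm
  | k :: ks, V => ((iterEquiv ks (V × Fin k)).trans (Equiv.prodAssoc _ _ _)).trans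
      (Equiv.prodCongr (Equiv.refl V)
        (finProdFinEquiv.trans (finCongr List.prod_cons.symm)))

lemma iterEquiv_fst (ks : List ℕ) {V : Type u} (x : IterVertex V ks) :
    (iterEquiv ks V x).1 = iterProj ks id x := by
  induction ks generalizing V with
  | nil => rfl
  | cons k ks ih =>
    have key : ∀ x : IterVertex (V × Fin k) ks,
        (iterEquiv ks (V × Fin k) x).1.1 = iterProj ks (id ∘ Prod.fst) x := fun x => by
      rw [ih, iterProj_eq ks (id ∘ Prod.fst)]
      rfl
    exact key x

instance iterVertexFintype {V : Type u} [Fintype V] (ks : List ℕ) : Fintype (IterVertex V ks) :=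
  Fintype.ofEquiv _ (iterEquiv ks V).symm

end GraphLift

namespace GraphLift

open Finset

/-! ### Concentration for random covers -/

/-- `P` is a random cover of `G` with fibres of size `k`, whose law is invariant under twists over
pairs of vertices of `G` by a family of `k` permutations, which is closed under inversion and acts
simply transitively on the fibres. -/
structure IsRandomCover {V W : Type*} (π : W → V) (G : SimpleGraph V) (k : ℕ)
    (P : PMF (SimpleGraph W)) : Prop where
  isCover : ∀ H ∈ P.support, IsCover π G H
  exists_twists : ∃ (Γ : Type) (_ : Fintype Γ) (inv : Γ ≃ Γ) (τ : Γ → Equiv.Perm W),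
    Fintype.card Γ = k ∧ (∀ γ, τ (inv γ) = (τ γ)⁻¹) ∧ (∀ γ x, π (τ γ x) = π x) ∧
      (∀ x y, π x = π y → ∃! γ, τ γ x = y) ∧ ∀ v w γ, P.map (twist π v w (τ γ)) = P

lemma card_iterShift (ks : List ℕ) : Nat.card (IterShift ks) = ks.prod := by
  induction ks with
  | nil => exact Nat.card_unique (α := Unit)
  | cons k ks ih =>
    change Nat.card (Fin k × IterShift ks) = _
    rw [Nat.card_prod, ih, Nat.card_fin, List.prod_cons]

lemma isRandomCover_iteratedLift {V : Type u} [Finite V] (G : SimpleGraph V) (ks : List ℕ) :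
    IsRandomCover (iterProj ks id) G ks.prod (iteratedLift ks G) where
  isCover _ h := isCover_of_mem_support_iteratedLift ks h
  exists_twists := by
    have := Fintype.ofFinite (IterShift ks)
    refine ⟨IterShift ks, this, iterNeg ks, iterPerm ks 1, ?_, fun a => ?_, fun a x => ?_,
      fun x y h => ?_, fun v w a => iteratedLift_map_twist ks G v w a⟩
    · rw [← Nat.card_eq_fintype_card, card_iterShift]
    · rw [← iterPerm_iterNeg, inv_one]
    · exact iterProj_iterPerm ks 1 a x
    · exact existsUnique_iterPerm ks 1 h.symm

lemma isRandomCover_randomLift {V : Type u} [Finite V] (G : SimpleGraph V) (k : ℕ) :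
    IsRandomCover Prod.fst G k (randomLift G k) := by
  have h := isRandomCover_iteratedLift G [k]
  have h1 : iteratedLift [k] G = randomLift G k := PMF.bind_pure (randomLift G k)
  rw [h1, List.prod_singleton] at h
  exact h

/-! ### The deviation matrix, its edge blocks and their variance -/

section Deviation

variable {V : Type*} {W : Type u}

open Classical in
/-- The weighted deviation of the adjacency matrix of a random cover from its mean. -/
def deviation (π : W → V) (G : SimpleGraph V) (k : ℕ) (c : V → ℝ) (H : SimpleGraph W) :
    Matrix W W ℝ :=
  Matrix.of fun x y =>
    c (π x) * c (π y) * (adj H x y - if G.Adj (π x) (π y) then (k : ℝ)⁻¹ else 0)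

open Classical in
/-- The part of a matrix over the pair `v, w`. -/
def block (π : W → V) (v w : V) (B : Matrix W W ℝ) : Matrix W W ℝ :=
  Matrix.of fun x y => if s(π x, π y) = s(v, w) then B x y else 0

open Classical in
lemma adj_apply (H : SimpleGraph W) (x y : W) : adj H x y = if H.Adj x y then 1 else 0 := by
  rw [adj, SimpleGraph.adjMatrix_apply]

lemma adj_comm (H : SimpleGraph W) (x y : W) : adj H x y = adj H y x := by
  rw [adj_apply, adj_apply, H.adj_comm]

lemma deviation_comm (π : W → V) (G : SimpleGraph V) (k : ℕ) (c : V → ℝ) (H : SimpleGraph W)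
    (x y : W) : deviation π G k c H x y = deviation π G k c H y x := by
  simp only [deviation, Matrix.of_apply]
  rw [adj_comm H x y, G.adj_comm (π x), mul_comm (c (π x))]

lemma isHermitian_deviation (π : W → V) (G : SimpleGraph V) (k : ℕ) (c : V → ℝ)
    (H : SimpleGraph W) : (deviation π G k c H).IsHermitian := by
  ext x y
  exact deviation_comm ..

lemma IsCover.deviation_eq_zero {π : W → V} {G : SimpleGraph V} {k : ℕ} {c : V → ℝ}
    {H : SimpleGraph W} (hH : IsCover π G H) {x y : W} (h : ¬ G.Adj (π x) (π y)) :
    deviation π G k c H x y = 0 := by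
  rw [deviation, Matrix.of_apply, adj_apply, if_neg h, if_neg fun h' => h (hH.1 _ _ h')]
  simp

lemma IsCover.block_deviation_eq_zero {π : W → V} {G : SimpleGraph V} {k : ℕ} {c : V → ℝ}
    {H : SimpleGraph W} (hH : IsCover π G H) {v w : V} (h : ¬ G.Adj v w) :
    block π v w (deviation π G k c H) = 0 := by
  ext x y
  rw [block, Matrix.of_apply]
  split_ifs with h1
  · refine hH.deviation_eq_zero fun h2 => h ?_
    rw [← SimpleGraph.mem_edgeSet, h1] at h2
    exact h2
  · rfl

/-- Summing over ordered pairs counts every edge block twice, whence the factor `1/2`. -/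
lemma IsCover.deviation_eq_sum_block [Fintype V] {π : W → V} {G : SimpleGraph V} {k : ℕ}
    {c : V → ℝ} {H : SimpleGraph W} (hH : IsCover π G H) :
    deviation π G k c H
      = (1 / 2 : ℝ) • ∑ q : V × V, block π q.1 q.2 (deviation π G k c H) := by
  classical
  ext x y
  rw [Matrix.smul_apply, Matrix.sum_apply]
  by_cases h : G.Adj (π x) (π y)
  · have h1 : ∀ q : V × V, block π q.1 q.2 (deviation π G k c H) x y
        = (if (π x, π y) = q then deviation π G k c H x y else 0)
          + if (π y, π x) = q then deviation π G k c H x y else 0 := by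
      rintro ⟨v, w⟩
      have h2 := h.ne
      simp only [block, Matrix.of_apply, Sym2.eq_iff, Prod.mk.injEq]
      by_cases h3 : π x = v ∧ π y = w
      · have h4 : ¬ (π y = v ∧ π x = w) := fun h5 => h2 (h3.1.trans h5.1.symm)
        rw [if_pos (Or.inl h3), if_pos h3, if_neg h4, add_zero]
      · by_cases h4 : π y = v ∧ π x = w
        · rw [if_pos (Or.inr ⟨h4.2, h4.1⟩), if_neg h3, if_pos h4, zero_add]
        · rw [if_neg (by tauto), if_neg h3, if_neg h4, zero_add]
    simp only [h1, sum_add_distrib, sum_ite_eq, mem_univ, if_true, smul_eq_mul]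
    ring
  · rw [hH.deviation_eq_zero h, sum_eq_zero, smul_zero]
    intro q _
    rw [block, Matrix.of_apply, hH.deviation_eq_zero h, ite_self]

lemma deviation_sub_twist (π : W → V) (G : SimpleGraph V) (k : ℕ) (c : V → ℝ) (H : SimpleGraph W)
    (v w : V) (τ : Equiv.Perm W) :
    deviation π G k c H - deviation π G k c (twist π v w τ H)
      = block π v w (deviation π G k c H)
        - block π v w (deviation π G k c (twist π v w τ H)) := by
  ext x y
  rw [Matrix.sub_apply, Matrix.sub_apply, block, block, Matrix.of_apply, Matrix.of_apply]
  by_cases h : s(π x, π y) = s(v, w)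
  · rw [if_pos h, if_pos h]
  · rw [if_neg h, if_neg h, sub_self, sub_eq_zero]
    rw [Sym2.eq_iff] at h
    have h1 : (twist π v w τ H).Adj x y ↔ H.Adj x y := by
      rw [twist_adj, twistVertex, twistVertex, if_neg (by tauto), if_neg (by tauto)]
    have h2 : adj H x y = adj (twist π v w τ H) x y := by
      rw [adj_apply, adj_apply]
      by_cases h2 : H.Adj x y
      · rw [if_pos h2, if_pos (h1.2 h2)]
      · rw [if_neg h2, if_neg (mt h1.1 h2)]
    rw [deviation, deviation, Matrix.of_apply, Matrix.of_apply, h2]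

lemma sum_ite_of_existsUnique {Γ : Type*} [Fintype Γ] {p : Γ → Prop} [DecidablePred p]
    (h : ∃! γ, p γ) : ∑ γ, (if p γ then (1 : ℝ) else 0) = 1 := by
  obtain ⟨γ, hγ, hγ'⟩ := h
  rw [sum_eq_single γ (fun γ' _ h' => if_neg fun hp => h' (hγ' _ hp)) (by simp), if_pos hγ]

/-- For `x` over `v` and `y` over `w`, simple transitivity moves the unique neighbour of `x` over
`w` to `y` for exactly one `γ`. The adjacency entries thus sum to `1`, which the `card Γ` copies of
the mean `1 / card Γ` cancel. -/
lemma IsCover.sum_block_twist {π : W → V} {G : SimpleGraph V} {H : SimpleGraph W}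
    (hH : IsCover π G H) {Γ : Type*} [Fintype Γ] [Nonempty Γ] {τ : Γ → Equiv.Perm W}
    (hτ : ∀ γ x, π (τ γ x) = π x) (hu : ∀ x y, π x = π y → ∃! γ, τ γ x = y) (c : V → ℝ)
    (v w : V) (htw : ∀ γ, IsCover π G (twist π v w (τ γ) H)) :
    ∑ γ, block π v w (deviation π G (Fintype.card Γ) c (twist π v w (τ γ) H)) = 0 := by
  classical
  by_cases h : G.Adj v w
  swap
  · exact sum_eq_zero fun γ _ => (htw γ).block_deviation_eq_zero h
  have key : ∀ x y, π x = v → π y = w →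
      ∑ γ, deviation π G (Fintype.card Γ) c (twist π v w (τ γ) H) x y = 0 := by
    rintro x y rfl rfl
    have h1 : ∀ γ, adj (twist π (π x) (π y) (τ γ) H) x y
        = if H.Adj x ((τ γ)⁻¹ y) then 1 else 0 := by
      intro γ
      have h2 := h.ne
      rw [adj_apply]
      refine if_congr ?_ rfl rfl
      rw [twist_adj, twistVertex, twistVertex, if_neg (fun h3 => h2 h3.1), if_pos ⟨rfl, rfl⟩]
    have h2 : ∃! γ, H.Adj x ((τ γ)⁻¹ y) := by
      obtain ⟨z, ⟨hz, hxz⟩, hz'⟩ := hH.2 x (π y) h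
      obtain ⟨γ, hγ, hγ'⟩ := hu z y hz
      refine ⟨γ, ?_, fun γ₁ h₁ => hγ' _ ?_⟩
      · have : (τ γ)⁻¹ y = z := (Equiv.Perm.eq_inv_iff_eq.2 hγ).symm
        change H.Adj x ((τ γ)⁻¹ y)
        rwa [this]
      · rw [← hz' _ ⟨proj_inv (hτ γ₁) y, h₁⟩]
        exact perm_apply_inv _ _
    have h3 : (Fintype.card Γ : ℝ) ≠ 0 := by exact_mod_cast Fintype.card_ne_zero
    simp only [deviation, Matrix.of_apply, h1, if_pos h]
    rw [← mul_sum, sum_sub_distrib, sum_ite_of_existsUnique h2]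
    simp [h3]
  ext x y
  rw [Matrix.sum_apply, Matrix.zero_apply]
  simp only [block, Matrix.of_apply]
  by_cases h1 : s(π x, π y) = s(v, w)
  · simp only [if_pos h1]
    rcases Sym2.eq_iff.1 h1 with ⟨h2, h3⟩ | ⟨h2, h3⟩
    · exact key x y h2 h3
    · simp only [deviation_comm _ _ _ _ _ x y]
      exact key y x h3 h2
  · simp only [if_neg h1, sum_const_zero]

lemma block_sub_block (π : W → V) (G : SimpleGraph V) (k : ℕ) (c : V → ℝ) (H H' : SimpleGraph W)
    (v w : V) :
    block π v w (deviation π G k c H) - block π v w (deviation π G k c H')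
      = (c v * c w) • (block π v w (adj H) - block π v w (adj H')) := by
  ext x y
  rw [Matrix.smul_apply, Matrix.sub_apply, Matrix.sub_apply]
  simp only [block, deviation, Matrix.of_apply]
  by_cases h : s(π x, π y) = s(v, w)
  · simp only [if_pos h]
    rcases Sym2.eq_iff.1 h with ⟨h2, h3⟩ | ⟨h2, h3⟩
    · rw [h2, h3, smul_eq_mul]
      ring
    · rw [h2, h3, smul_eq_mul]
      ring
  · simp [if_neg h]

lemma isHermitian_block_adj (π : W → V) (v w : V) (H : SimpleGraph W) :
    (block π v w (adj H)).IsHermitian := by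
  ext x y
  rw [Matrix.conjTranspose_apply, star_trivial, block, Matrix.of_apply, Matrix.of_apply,
    Sym2.eq_swap, adj_comm]

variable [Fintype W] [DecidableEq W] [DecidableEq V]

/-- The block is the permutation matrix of the involution that exchanges matched vertices of the two
fibres, extended by zero. -/
lemma IsCover.block_adj_sq {π : W → V} {G : SimpleGraph V} {H : SimpleGraph W}
    (hH : IsCover π G H) {v w : V} (h : G.Adj v w) :
    block π v w (adj H) ^ 2 = Matrix.diagonal fun x => if π x = v ∨ π x = w then 1 else 0 := by
  classical
  ext x z
  rw [pow_two, Matrix.mul_apply]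
  by_cases hx : π x = v ∨ π x = w
  · obtain ⟨w', hw'⟩ : ∃ w', s(π x, w') = s(v, w) := by
      rcases hx with hx | hx
      · exact ⟨w, by rw [hx]⟩
      · exact ⟨v, by rw [hx, Sym2.eq_swap]⟩
    have hadj : G.Adj (π x) w' := by
      rw [← SimpleGraph.mem_edgeSet, hw']
      exact h
    obtain ⟨y, ⟨hy1, hy2⟩, hy3⟩ := hH.2 x w' hadj
    have h1 : ∀ y', block π v w (adj H) x y' = if y' = y then 1 else 0 := by
      intro y'
      simp only [block, Matrix.of_apply, ← hw', Sym2.congr_right, adj_apply, ← ite_and]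
      refine if_congr ⟨hy3 y', ?_⟩ rfl rfl
      rintro rfl
      exact ⟨hy1, hy2⟩
    have h2 : block π v w (adj H) y z = if z = x then 1 else 0 := by
      have h3 : s(w', π z) = s(π x, w') ↔ π z = π x := by rw [Sym2.eq_swap, Sym2.congr_left]
      simp only [block, Matrix.of_apply, hy1, ← hw', h3, adj_apply, ← ite_and]
      refine if_congr ⟨fun h3 => ?_, ?_⟩ rfl rfl
      · obtain ⟨x', hx1, hx2⟩ := hH.2 y (π x) (by rw [hy1]; exact hadj.symm)
        rw [hx2 z h3, hx2 x ⟨rfl, hy2.symm⟩]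
      · rintro rfl
        exact ⟨rfl, hy2.symm⟩
    simp only [h1, ite_mul, one_mul, zero_mul, sum_ite_eq', mem_univ, if_true, h2]
    rw [Matrix.diagonal_apply, if_pos hx]
    exact if_congr eq_comm rfl rfl
  · have h1 : ∀ y', block π v w (adj H) x y' = 0 := by
      intro y'
      rw [block, Matrix.of_apply, if_neg]
      rw [Sym2.eq_iff]
      tauto
    simp [h1, Matrix.diagonal_apply, hx]

/-- The means cancel in `X - X'`, leaving a multiple of a difference `A - A'` of matching matrices.
Then `(A - A')² = 2A² + 2A'² - (A + A')²`, where `A² = A'²` is the projection to the two fibres and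
the last square can be dropped. -/
lemma posSemidef_variance [Fintype V] {π : W → V} {G : SimpleGraph V} [DecidableRel G.Adj]
    {H : SimpleGraph W} (hH : IsCover π G H) {H' : V × V → SimpleGraph W}
    (hH' : ∀ q, IsCover π G (H' q)) (k : ℕ) {c : V → ℝ} {s : ℝ}
    (hs : ∀ v, ∑ w, (if G.Adj v w then (c v * c w) ^ 2 else 0) ≤ s) :
    ((4 * s) • (1 : Matrix W W ℝ) - (1 / 2 : ℝ) • ∑ q : V × V,
      (block π q.1 q.2 (deviation π G k c H)
        - block π q.1 q.2 (deviation π G k c (H' q))) ^ 2).PosSemidef := by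
  set a : V × V → ℝ := fun q => if G.Adj q.1 q.2 then (c q.1 * c q.2) ^ 2 else 0 with ha
  have ha0 : ∀ q, 0 ≤ a q := fun q => by
    simp only [ha]
    split_ifs <;> positivity
  have ha' : ∀ v w, a (v, w) = a (w, v) := fun v w =>
    if_congr (G.adj_comm _ _) (by ring) rfl
  set D : V × V → Matrix W W ℝ :=
    fun q => Matrix.diagonal (fun x => if π x = q.1 ∨ π x = q.2 then (1 : ℝ) else 0) with hD
  set B : V × V → Matrix W W ℝ :=
    fun q => (block π q.1 q.2 (adj H) + block π q.1 q.2 (adj (H' q))) ^ 2 with hB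
  have h1 : ∀ q : V × V, (block π q.1 q.2 (deviation π G k c H)
        - block π q.1 q.2 (deviation π G k c (H' q))) ^ 2 = (4 * a q) • D q - a q • B q := by
    intro q
    by_cases h : G.Adj q.1 q.2
    · have h2 : a q = (c q.1 * c q.2) ^ 2 := if_pos h
      rw [block_sub_block, h2, smul_pow, mul_comm (4 : ℝ), mul_smul, ← smul_sub]
      congr 1
      have e1 : block π q.1 q.2 (adj H) ^ 2 = D q := hH.block_adj_sq h
      have e2 : block π q.1 q.2 (adj (H' q)) ^ 2 = D q := (hH' q).block_adj_sq h
      simp only [hB]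
      set A := block π q.1 q.2 (adj H)
      set A' := block π q.1 q.2 (adj (H' q))
      have e3 : (4 : ℝ) • D q = A ^ 2 + A ^ 2 + A' ^ 2 + A' ^ 2 := by
        rw [e1, e2]
        module
      rw [e3]
      noncomm_ring
    · have h2 : a q = 0 := if_neg h
      rw [hH.block_deviation_eq_zero h, (hH' q).block_deviation_eq_zero h, h2]
      simp
  have h2 : (4 * s) • (1 : Matrix W W ℝ) - (1 / 2 : ℝ) • ∑ q : V × V, (4 * a q) • D q
      = Matrix.diagonal (fun x => 4 * s - (1 / 2) * ∑ q : V × V,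
          4 * a q * (if π x = q.1 ∨ π x = q.2 then (1 : ℝ) else 0)) := by
    ext x y
    simp only [hD, Matrix.sub_apply, Matrix.smul_apply, Matrix.sum_apply, Matrix.diagonal_apply,
      Matrix.one_apply, smul_eq_mul]
    by_cases hxy : x = y
    · simp only [if_pos hxy, mul_one]
    · simp only [if_neg hxy, mul_zero, sum_const_zero, sub_zero]
  simp only [h1, sum_sub_distrib]
  rw [smul_sub, sub_sub_eq_add_sub, add_sub_right_comm, h2]
  refine Matrix.PosSemidef.add (Matrix.PosSemidef.diagonal fun x => ?_)
    (Matrix.PosSemidef.smul (Matrix.posSemidef_sum _ fun q _ =>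
      Matrix.PosSemidef.smul ?_ (ha0 q)) (by norm_num))
  -- The vertex `π x` may be the first or the second entry of `q`. Each case contributes at most `4
  -- * s`, and the factor `1/2` turns the total `8 * s` into `4 * s`.
  · have h3 : ∑ q : V × V, 4 * a q * (if π x = q.1 ∨ π x = q.2 then (1 : ℝ) else 0)
        ≤ ∑ q : V × V, (if π x = q.1 then 4 * a (π x, q.2) else 0)
          + ∑ q : V × V, (if π x = q.2 then 4 * a (π x, q.1) else 0) := by
      rw [← sum_add_distrib]
      refine sum_le_sum fun q _ => ?_
      have p1 : ∀ q, 0 ≤ 4 * a q := fun q => mul_nonneg zero_le_four (ha0 q)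
      by_cases h4 : π x = q.1
      · rw [if_pos (Or.inl h4), if_pos h4, mul_one, h4]
        refine le_add_of_nonneg_right ?_
        split_ifs
        · exact p1 _
        · exact le_rfl
      · by_cases h5 : π x = q.2
        · rw [if_pos (Or.inr h5), if_neg h4, if_pos h5, mul_one, zero_add, h5, ha']
        · rw [if_neg (not_or.2 ⟨h4, h5⟩), if_neg h4, if_neg h5, mul_zero, add_zero]
    have h4 : ∑ w, 4 * a (π x, w) ≤ 4 * s := by
      rw [← mul_sum]
      exact mul_le_mul_of_nonneg_left (hs (π x)) zero_le_four
    have h5 : ∑ q : V × V, (if π x = q.1 then 4 * a (π x, q.2) else 0) = ∑ w, 4 * a (π x, w) := by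
      rw [Fintype.sum_prod_type_right]
      simp
    have h6 : ∑ q : V × V, (if π x = q.2 then 4 * a (π x, q.1) else 0) = ∑ w, 4 * a (π x, w) := by
      rw [Fintype.sum_prod_type]
      simp
    change (0 : ℝ) ≤ _
    linarith
  · have := Matrix.posSemidef_conjTranspose_mul_self
      (block π q.1 q.2 (adj H) + block π q.1 q.2 (adj (H' q)))
    rwa [((isHermitian_block_adj π q.1 q.2 H).add (isHermitian_block_adj π q.1 q.2 (H' q))).eq,
      ← pow_two] at this

end Deviation

end GraphLift

namespace GraphLift

open Finset

/-! ### From moments to tail bounds -/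

lemma pmf_map_equiv_apply {α β : Type*} (P : PMF α) (e : α ≃ β) (a : α) :
    P.map e (e a) = P a := by
  classical
  rw [PMF.map_apply, tsum_eq_single a]
  · simp
  · intro b hb
    rw [if_neg]
    simpa using hb.symm

lemma sum_pmf_toReal {α : Type*} [Fintype α] (P : PMF α) : ∑ a, (P a).toReal = 1 := by
  rw [← ENNReal.toReal_sum fun a _ => P.apply_ne_top a, ← tsum_fintype (L := .unconditional α),
    P.tsum_coe, ENNReal.toReal_one]

lemma markov_pow {α : Type*} [Fintype α] (P : PMF α) {f : α → ℝ} (hf : ∀ a, 0 ≤ f a) {C t ε : ℝ}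
    (ht : 0 ≤ t) (hε : 0 ≤ ε) (hC : ∑ a, (P a).toReal * f a ≤ C) (hCt : C ≤ ε * t)
    (B : Finset α) (hB : ∀ a ∈ B, t < f a) : ∑ a ∈ B, (P a).toReal ≤ ε := by
  have h1 : ∑ a ∈ B, (P a).toReal * f a ≤ ε * t :=
    (sum_le_univ_sum_of_nonneg fun a => mul_nonneg ENNReal.toReal_nonneg (hf a)).trans
      (hC.trans hCt)
  -- The case `t = 0` does occur, for instance when `s = 0`; then the bad points carry no mass.
  rcases ht.eq_or_lt with rfl | ht
  · rw [mul_zero] at h1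
    have h2 : ∀ a ∈ B, (P a).toReal = 0 := fun a ha => by
      have h3 : (P a).toReal * f a ≤ _ := single_le_sum (f := fun a => (P a).toReal * f a)
        (fun a _ => mul_nonneg ENNReal.toReal_nonneg (hf a)) ha
      have h4 := hB a ha
      have h5 : (0 : ℝ) ≤ (P a).toReal := ENNReal.toReal_nonneg
      nlinarith
    rw [sum_eq_zero h2]
    exact hε
  · have h2 : (∑ a ∈ B, (P a).toReal) * t ≤ ε * t := by
      refine le_trans ?_ h1
      rw [sum_mul]
      exact sum_le_sum fun a ha =>
        mul_le_mul_of_nonneg_left (hB a ha).le ENNReal.toReal_nonneg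
    exact le_of_mul_le_mul_right h2 ht

instance measurableSingletonClass_simpleGraph {α : Type*} [Countable α] :
    MeasurableSingletonClass (SimpleGraph α) where
  measurableSet_singleton H := by
    have h : ({H} : Set (SimpleGraph α)) = ⋂ (x : α) (y : α), {K | K.Adj x y ↔ H.Adj x y} := by
      ext K
      simp only [Set.mem_singleton_iff, Set.mem_iInter, Set.mem_ofPred_eq]
      exact ⟨fun h _ _ => by rw [h], fun h => SimpleGraph.ext (by ext x y; exact h x y)⟩
    rw [h]
    refine MeasurableSet.iInter fun x => MeasurableSet.iInter fun y => ?_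
    have h1 : Measurable fun K : SimpleGraph α => K.Adj x y :=
      SimpleGraph.measurable_iff_adj.1 measurable_id x y
    exact (h1.iff measurable_const).setOf

/-- Let `L = log (4N/δ)` and `n = ⌈L⌉₊`. As `L ≥ 1`, `n ≤ 2L`, so `4sn ≤ 8sL`. The squared threshold
is `256sL = 8sL * 32`, and the spare factor `32^n ≥ exp L = 4N/δ` absorbs both `N` and `δ/2`. -/
lemma exists_moment_exponent {N s δ : ℝ} (hN : 1 ≤ N) (hs : 0 ≤ s) (hδ : 0 < δ) (hδ1 : δ < 1) :
    ∃ n : ℕ, n ≠ 0 ∧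
      (4 * s * n) ^ n * N ≤ δ / 2 * (16 * Real.sqrt (s * Real.log (4 * N / δ))) ^ (2 * n) := by
  set L := Real.log (4 * N / δ) with hL
  have h4 : 4 ≤ 4 * N / δ := by
    rw [le_div_iff₀ hδ]
    nlinarith
  have hL1 : 1 ≤ L := by
    rw [hL, Real.le_log_iff_exp_le (by linarith)]
    linarith [Real.exp_one_lt_d9]
  refine ⟨⌈L⌉₊, (Nat.ceil_pos.2 (by linarith)).ne', ?_⟩
  have h1 : (⌈L⌉₊ : ℝ) ≤ 2 * L := by linarith [Nat.ceil_lt_add_one (show 0 ≤ L by linarith)]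
  have h2 : N ≤ δ / 2 * 32 ^ ⌈L⌉₊ := by
    have h3 : 4 * N / δ ≤ 3 ^ ⌈L⌉₊ := by
      rw [← Real.exp_log (show 0 < 4 * N / δ by linarith), ← hL]
      calc Real.exp L ≤ Real.exp ⌈L⌉₊ := Real.exp_le_exp.2 (Nat.le_ceil L)
        _ = Real.exp 1 ^ ⌈L⌉₊ := by rw [← Real.exp_nat_mul, mul_one]
        _ ≤ 3 ^ ⌈L⌉₊ := by
          gcongr
          linarith [Real.exp_one_lt_d9]
    have h5 : (3 : ℝ) ^ ⌈L⌉₊ ≤ 32 ^ ⌈L⌉₊ := by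
      gcongr
      norm_num
    rw [div_le_iff₀ hδ] at h3
    nlinarith
  have h3 : (16 * Real.sqrt (s * L)) ^ (2 * ⌈L⌉₊) = (8 * s * L) ^ ⌈L⌉₊ * 32 ^ ⌈L⌉₊ := by
    rw [pow_mul, mul_pow, Real.sq_sqrt (by positivity), ← mul_pow]
    congr 1
    ring
  rw [h3, mul_left_comm]
  refine mul_le_mul (pow_le_pow_left₀ (by positivity) ?_ _) h2 (by linarith) (by positivity)
  nlinarith

section Tail

variable {V : Type*} {W : Type u} [Fintype V] [Fintype W] [DecidableEq W]
  [Fintype (SimpleGraph W)] {π : W → V} {G : SimpleGraph V} [DecidableRel G.Adj] {k : ℕ}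
  {P : PMF (SimpleGraph W)} {c : V → ℝ} {s : ℝ}

lemma IsRandomCover.sum_trace_deviation_pow_le (hP : IsRandomCover π G k P) (hk : k ≠ 0)
    (hs0 : 0 ≤ s) (hs : ∀ v, ∑ w, (if G.Adj v w then (c v * c w) ^ 2 else 0) ≤ s) (n : ℕ) :
    ∑ H, (P H).toReal * (deviation π G k c H ^ (2 * n)).trace
      ≤ (4 * s * n) ^ n * Fintype.card W := by
  classical
  obtain ⟨hcov, Γ, _, inv, τ, rfl, hinv, hτ, hu, htw⟩ := hP
  have : Nonempty Γ := Fintype.card_pos_iff.1 (Nat.pos_of_ne_zero hk)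
  have hcov' : ∀ H, (P H).toReal ≠ 0 → IsCover π G H := fun H h =>
    hcov H fun h0 => h (by rw [h0, ENNReal.toReal_zero])
  have hp : ∀ v w γ H, (P (twist π v w (τ γ) H)).toReal = (P H).toReal := by
    intro v w γ H
    have h := pmf_map_equiv_apply P (twistEquiv π v w (τ γ) (hτ γ)) H
    change P.map (twist π v w (τ γ)) (twist π v w (τ γ) H) = P H at h
    rw [htw] at h
    rw [h]
  have hcovt : ∀ v w γ H, (P H).toReal ≠ 0 → IsCover π G (twist π v w (τ γ) H) := fun v w γ H h =>
    hcov' _ (by rwa [hp])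
  refine sum_trace_pow_le (fun _ => ENNReal.toReal_nonneg) (sum_pmf_toReal P)
    (fun H => isHermitian_deviation π G _ c H) (mul_nonneg zero_le_four hs0) (fun m hm => ?_) n n
    le_rfl
  refine sum_trace_pow_step (ι := V × V) (Γ := Γ) (r := 1 / 2)
    (X := fun q H => block π q.1 q.2 (deviation π G (Fintype.card Γ) c H))
    (fun _ => ENNReal.toReal_nonneg) (fun H => isHermitian_deviation π G _ c H) (by norm_num)
    (fun H h => (hcov' H h).deviation_eq_sum_block)
    (fun q γ => twistEquiv π q.1 q.2 (τ γ) (hτ γ)) inv (fun q γ H => ?_)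
    (fun q γ H => hp _ _ _ _)
    (fun q H h => (hcov' H h).sum_block_twist hτ hu c q.1 q.2 fun γ => hcovt _ _ _ _ h)
    (fun q H _ γ => deviation_sub_twist π G _ c H q.1 q.2 (τ γ))
    (fun H h γ => posSemidef_variance (hcov' H h) (fun q => hcovt q.1 q.2 γ H h) _ hs) hm
  change twist π q.1 q.2 (τ (inv γ)) (twist π q.1 q.2 (τ γ) H) = H
  rw [hinv, twist_twist (proj_inv (hτ γ)), inv_mul_cancel, twist_one]

/-- The tail bound for the deviation of a random cover, in terms of an even moment. -/
lemma IsRandomCover.exists_tail (hP : IsRandomCover π G k P) (hk : k ≠ 0)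
    (hs0 : 0 ≤ s) (hs : ∀ v, ∑ w, (if G.Adj v w then (c v * c w) ^ 2 else 0) ≤ s) {δ : ℝ}
    (hδ : 0 < δ) (hδ1 : δ < 1) :
    ∃ n : ℕ, n ≠ 0 ∧ P.toMeasure.real {H | ¬ (IsCover π G H ∧
      (deviation π G k c H ^ (2 * n)).trace
        ≤ (16 * Real.sqrt (s * Real.log (4 * Fintype.card W / δ))) ^ (2 * n))} ≤ δ / 2 := by
  classical
  obtain ⟨n, hn, h⟩ : ∃ n : ℕ, n ≠ 0 ∧ (4 * s * n) ^ n * Fintype.card W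
      ≤ δ / 2 * (16 * Real.sqrt (s * Real.log (4 * Fintype.card W / δ))) ^ (2 * n) := by
    rcases Nat.eq_zero_or_pos (Fintype.card W) with h0 | h0
    · refine ⟨1, one_ne_zero, ?_⟩
      rw [h0, Nat.cast_zero, mul_zero]
      positivity
    · exact exists_moment_exponent (by exact_mod_cast h0) hs0 hδ hδ1
  refine ⟨n, hn, ?_⟩
  set t := (16 * Real.sqrt (s * Real.log (4 * Fintype.card W / δ))) ^ (2 * n) with ht
  let B : Finset (SimpleGraph W) := {H | t < (deviation π G k c H ^ (2 * n)).trace}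
  have h1 : ∑ H ∈ B, (P H).toReal ≤ δ / 2 :=
    markov_pow P (fun H => trace_pow_nonneg (isHermitian_deviation π G k c H) (even_two_mul n))
      (by positivity) (by positivity) (hP.sum_trace_deviation_pow_le hk hs0 hs n) h B (by simp [B])
  have h2 : P.toMeasure {H | ¬ (IsCover π G H ∧ (deviation π G k c H ^ (2 * n)).trace ≤ t)}
      ≤ P.toMeasure B := by
    refine P.toMeasure_mono (Set.toFinite _).measurableSet fun H hH => ?_
    obtain ⟨h3, h4⟩ := hH
    have h5 := fun h => h3 ⟨hP.isCover H h4, h⟩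
    simpa [B] using h5
  rw [PMF.toMeasure_apply_finset] at h2
  have h3 := ENNReal.toReal_mono (ENNReal.sum_ne_top.2 fun H _ => P.apply_ne_top H) h2
  rw [ENNReal.toReal_sum fun H _ => P.apply_ne_top H] at h3
  exact h3.trans h1

end Tail

/-! ### Comparison of two random covers -/

section Compare

variable {V : Type u} {W : Type u}

lemma adj_relabel {W' : Type u} (φ : W ≃ W') (H : SimpleGraph W) (x y : W') :
    adj (relabel φ H) x y = adj H (φ.symm x) (φ.symm y) := by
  have h : (relabel φ H).Adj x y ↔ H.Adj (φ.symm x) (φ.symm y) := by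
    rw [relabel, SimpleGraph.map_adj]
    constructor
    · rintro ⟨a, b, hab, rfl, rfl⟩
      simpa using hab
    · intro h
      exact ⟨_, _, h, by simp, by simp⟩
  rw [adj_apply, adj_apply]
  by_cases h2 : H.Adj (φ.symm x) (φ.symm y)
  · rw [if_pos h2, if_pos (h.2 h2)]
  · rw [if_neg h2, if_neg (mt h.1 h2)]

lemma deviation_relabel {W' : Type u} {π : W → V} {π' : W' → V} (φ : W ≃ W')
    (hφ : ∀ x, π' (φ x) = π x) (G : SimpleGraph V) (k : ℕ) (c : V → ℝ) (H : SimpleGraph W) :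
    deviation π' G k c (relabel φ H) = (deviation π G k c H).submatrix φ.symm φ.symm := by
  have h : ∀ x, π (φ.symm x) = π' x := fun x => by rw [← hφ, Equiv.apply_symm_apply]
  ext x y
  simp only [deviation, Matrix.of_apply, Matrix.submatrix_apply, adj_relabel]
  rw [h x, h y]

lemma IsCover.relabel {W' : Type u} {π : W → V} {π' : W' → V} (φ : W ≃ W')
    (hφ : ∀ x, π' (φ x) = π x) {G : SimpleGraph V} {H : SimpleGraph W} (hH : IsCover π G H) :
    IsCover π' G (relabel φ H) := by
  have h : ∀ x y, (GraphLift.relabel φ H).Adj (φ x) (φ y) ↔ H.Adj x y := fun x y =>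
    SimpleGraph.map_adj_apply
  refine ⟨fun x y hxy => ?_, fun x w hxw => ?_⟩
  · obtain ⟨x, rfl⟩ := φ.surjective x
    obtain ⟨y, rfl⟩ := φ.surjective y
    rw [hφ, hφ]
    exact hH.1 _ _ ((h x y).1 hxy)
  · obtain ⟨x, rfl⟩ := φ.surjective x
    rw [hφ] at hxw
    obtain ⟨y, ⟨hy1, hy2⟩, hy3⟩ := hH.2 x w hxw
    refine ⟨φ y, ⟨by rw [hφ, hy1], (h x y).2 hy2⟩, fun z ⟨hz1, hz2⟩ => ?_⟩
    obtain ⟨z, rfl⟩ := φ.surjective z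
    rw [hφ] at hz1
    rw [hy3 z ⟨hz1, (h x z).1 hz2⟩]

lemma trace_submatrix_pow {W' : Type u} [Fintype W] [Fintype W'] [DecidableEq W] [DecidableEq W']
    (e : W' ≃ W) (B : Matrix W W ℝ) (n : ℕ) : (B.submatrix e e ^ n).trace = (B ^ n).trace := by
  have h : B.submatrix e e ^ n = (B ^ n).submatrix e e := by
    induction n with
    | zero => rw [pow_zero, pow_zero, Matrix.submatrix_one_equiv]
    | succ n ih => rw [pow_succ, pow_succ, ih, Matrix.submatrix_mul_equiv]
  rw [h, Matrix.trace, Matrix.trace]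
  exact Equiv.sum_comp e fun x => (B ^ n) x x

lemma opNorm_sub_le [Fintype W] (B C : Matrix W W ℝ) : opNorm (B - C) ≤ opNorm B + opNorm C := by
  classical
  unfold opNorm
  rw [map_sub]
  exact norm_sub_le _ _

lemma opNorm_sub_comm [Fintype W] (B C : Matrix W W ℝ) : opNorm (B - C) = opNorm (C - B) := by
  classical
  unfold opNorm
  rw [map_sub, map_sub, norm_sub_rev]

lemma deviation_one_sub (π : W → V) (G : SimpleGraph V) (k : ℕ) (H H' : SimpleGraph W) :
    deviation π G k (fun _ => 1) H - deviation π G k (fun _ => 1) H' = adj H - adj H' := by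
  ext x y
  simp only [deviation, Matrix.of_apply, Matrix.sub_apply]
  ring

open Classical in
lemma IsCover.degree_eq [Fintype V] [Fintype W] {π : W → V} {G : SimpleGraph V}
    {H : SimpleGraph W} (hH : IsCover π G H) (x : W) : H.degree x = G.degree (π x) := by
  rw [← SimpleGraph.card_neighborFinset_eq_degree, ← SimpleGraph.card_neighborFinset_eq_degree]
  refine card_bij (fun y _ => π y) (fun y hy => ?_) (fun y hy z hz hyz => ?_) (fun w hw => ?_)
  · rw [SimpleGraph.mem_neighborFinset] at hy ⊢
    exact hH.1 _ _ hy
  · rw [SimpleGraph.mem_neighborFinset] at hy hz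
    exact (hH.2 x (π y) (hH.1 _ _ hy)).unique ⟨rfl, hy⟩ ⟨hyz.symm, hz⟩
  · rw [SimpleGraph.mem_neighborFinset] at hw
    obtain ⟨y, ⟨hy1, hy2⟩, -⟩ := hH.2 x w hw
    exact ⟨y, by rwa [SimpleGraph.mem_neighborFinset], hy1⟩

open Classical in
/-- The weight of a vertex in the definition of the Laplacian. -/
def laplacianWeight [Fintype V] (G : SimpleGraph V) (v : V) : ℝ :=
  if G.degree v = 0 then 0 else 1 / Real.sqrt (G.degree v)

/-- Covers preserve degrees, so both Laplacians have the same diagonal scaling, namely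
`laplacianWeight G` composed with `π`. The identity matrices and the means cancel, and the minus
sign of the Laplacian swaps the order. -/
lemma deviation_laplacianWeight_sub [Fintype V] [Fintype W] {π : W → V} {G : SimpleGraph V}
    (k : ℕ) {H H' : SimpleGraph W} (hH : IsCover π G H) (hH' : IsCover π G H') :
    deviation π G k (laplacianWeight G) H - deviation π G k (laplacianWeight G) H'
      = laplacian H' - laplacian H := by
  classical
  ext x y
  simp only [deviation, laplacian, laplacianWeight, hH.degree_eq, hH'.degree_eq, Matrix.of_apply,
    Matrix.sub_apply, Matrix.mul_diagonal, Matrix.diagonal_mul]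
  ring

lemma sum_weight_one_le [Fintype V] (G : SimpleGraph V) [DecidableRel G.Adj] (v : V) :
    ∑ w, (if G.Adj v w then ((1 : ℝ) * 1) ^ 2 else 0) ≤ (G.maxDegree : ℝ) := by
  simp only [mul_one, one_pow, sum_boole]
  rw [← SimpleGraph.neighborFinset_eq_filter]
  exact_mod_cast G.degree_le_maxDegree v

/-- Each of the `deg v` neighbours contributes `1 / (deg v * deg w)`, which is at most `1 / (deg v *
d)`. -/
lemma sum_laplacianWeight_le [Fintype V] (G : SimpleGraph V) [DecidableRel G.Adj]
    (hd : 0 < G.minDegree) (v : V) :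
    ∑ w, (if G.Adj v w then (laplacianWeight G v * laplacianWeight G w) ^ 2 else 0)
      ≤ (1 / G.minDegree : ℝ) := by
  have h0 : ∀ w, (0 : ℝ) < G.degree w := fun w => by
    exact_mod_cast hd.trans_le (G.minDegree_le_degree w)
  have h1 : ∀ w, laplacianWeight G w ^ 2 = 1 / (G.degree w : ℝ) := by
    intro w
    have h2 : laplacianWeight G w = 1 / Real.sqrt (G.degree w) := by
      have h3 : G.degree w ≠ 0 := fun h => (h0 w).ne' (by rw [h, Nat.cast_zero])
      unfold laplacianWeight
      split_ifs with h4
      · exact absurd (by convert h4) h3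
      · congr!
    rw [h2, div_pow, one_pow, Real.sq_sqrt (h0 w).le]
  have hd' : (0 : ℝ) < G.minDegree := by exact_mod_cast hd
  calc ∑ w, (if G.Adj v w then (laplacianWeight G v * laplacianWeight G w) ^ 2 else 0)
      ≤ ∑ w, (if G.Adj v w then 1 / (G.degree v : ℝ) * (1 / G.minDegree) else 0) := by
        refine sum_le_sum fun w _ => ?_
        split_ifs
        · rw [mul_pow, h1, h1]
          have h2 : (G.minDegree : ℝ) ≤ G.degree w := by exact_mod_cast G.minDegree_le_degree w
          have := one_div_le_one_div_of_le hd' h2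
          have := h0 v
          gcongr
        · exact le_rfl
    _ = 1 / G.minDegree := by
        rw [← sum_filter, sum_const, ← SimpleGraph.neighborFinset_eq_filter,
          SimpleGraph.card_neighborFinset_eq_degree, nsmul_eq_mul, ← mul_assoc,
          mul_one_div_cancel (h0 v).ne', one_mul]

lemma one_sub_le_measureReal {Ω : Type*} [MeasurableSpace Ω] {μ : Measure Ω}
    [IsProbabilityMeasure μ] {A B C : Set Ω} {δ : ℝ} (hA : μ.real A ≤ δ / 2)
    (hB : μ.real B ≤ δ / 2) (h : ∀ ω, ω ∉ A → ω ∉ B → ω ∈ C) : 1 - δ ≤ μ.real C := by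
  have h1 : (Set.univ : Set Ω) ⊆ (A ∪ B) ∪ C := fun ω _ => by
    by_cases hωA : ω ∈ A
    · exact Or.inl (Or.inl hωA)
    · by_cases hωB : ω ∈ B
      · exact Or.inl (Or.inr hωB)
      · exact Or.inr (h ω hωA hωB)
  have h2 := (measureReal_mono h1 (measure_ne_top μ _)).trans (measureReal_union_le (A ∪ B) C)
  have h3 := measureReal_union_le (μ := μ) A B
  rw [probReal_univ] at h2
  linarith

/-- Two random covers of `G` are close to each other, as both are close to their common mean. -/
lemma one_sub_le_measureReal_opNorm [Fintype V] {W' : Type u} [Fintype W] [Fintype W']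
    {π : W → V} {π' : W' → V} (φ : W' ≃ W) (hφ : ∀ x, π (φ x) = π' x) {G : SimpleGraph V}
    [DecidableRel G.Adj] {k : ℕ} (hk : k ≠ 0) {P : PMF (SimpleGraph W)}
    {P' : PMF (SimpleGraph W')} (hP : IsRandomCover π G k P) (hP' : IsRandomCover π' G k P')
    {c : V → ℝ} {s : ℝ} (hs0 : 0 ≤ s)
    (hs : ∀ v, ∑ w, (if G.Adj v w then (c v * c w) ^ 2 else 0) ≤ s)
    {Ω : Type*} [MeasurableSpace Ω] {μ : Measure Ω} [IsProbabilityMeasure μ]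
    {X : Ω → SimpleGraph W} {Y : Ω → SimpleGraph W'} (hX : HasLaw X P.toMeasure μ)
    (hY : HasLaw Y P'.toMeasure μ) {δ : ℝ} (hδ : 0 < δ) (hδ1 : δ < 1) :
    1 - δ ≤ μ.real {ω | IsCover π G (X ω) ∧ IsCover π G (relabel φ (Y ω)) ∧
      opNorm (deviation π G k c (X ω) - deviation π G k c (relabel φ (Y ω)))
        ≤ 32 * Real.sqrt (s * Real.log (4 * Fintype.card W / δ))} := by
  classical
  have := Fintype.ofFinite (SimpleGraph W)
  have := Fintype.ofFinite (SimpleGraph W')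
  obtain ⟨n, hn, h1⟩ := hP.exists_tail hk hs0 hs hδ hδ1
  obtain ⟨m, hm, h2⟩ := hP'.exists_tail hk hs0 hs hδ hδ1
  rw [Fintype.card_congr φ] at h2
  rw [← hX.measureReal_eq (Set.toFinite _).measurableSet] at h1
  rw [← hY.measureReal_eq (Set.toFinite _).measurableSet] at h2
  refine one_sub_le_measureReal h1 h2 fun ω hX' hY' => ?_
  rw [Set.mem_ofPred_eq, not_not] at hX' hY'
  refine ⟨hX'.1, hY'.1.relabel φ hφ, (opNorm_sub_le _ _).trans ?_⟩
  have h3 := opNorm_le_of_trace_pow_le (isHermitian_deviation π G k c (X ω)) (even_two_mul n)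
    (by omega) (by positivity) hX'.2
  have h4 := hY'.2
  rw [← trace_submatrix_pow φ.symm, ← deviation_relabel φ hφ] at h4
  have h5 := opNorm_le_of_trace_pow_le (isHermitian_deviation π G k c (relabel φ (Y ω)))
    (even_two_mul m) (by omega) (by positivity) h4
  linarith

end Compare

end GraphLift

end

/-! ### The two estimates, with weights `1` and `laplacianWeight G` -/

theorem corollary1 {V : Type u} [Fintype V] (ks : List ℕ) (hks : ∀ k ∈ ks, 2 ≤ k) :
    ∃ φ : GraphLift.IterVertex V ks ≃ V × Fin ks.prod,
      ∀ (G : SimpleGraph V) [DecidableRel G.Adj]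
        (Ω : Type*) [MeasurableSpace Ω] (μ : Measure Ω) [IsProbabilityMeasure μ]
        (X : Ω → SimpleGraph (V × Fin ks.prod)) (Y : Ω → SimpleGraph (GraphLift.IterVertex V ks)),
        HasLaw X (GraphLift.randomLift G ks.prod).toMeasure μ →
        HasLaw Y (GraphLift.iteratedLift ks G).toMeasure μ →
        ∀ δ : ℝ, 0 < δ → δ < 1 →
          1 - δ ≤ μ.real {ω |
            GraphLift.opNorm
                (GraphLift.adj (X ω) - GraphLift.adj (GraphLift.relabel φ (Y ω)))
              ≤ 32 * Real.sqrt
                  (G.maxDegree * Real.log (4 * Fintype.card V * ks.prod / δ))} ∧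
          (0 < G.minDegree →
            1 - δ ≤ μ.real {ω |
              GraphLift.opNorm
                  (GraphLift.laplacian (X ω)
                    - GraphLift.laplacian (GraphLift.relabel φ (Y ω)))
                ≤ 32 * Real.sqrt
                    (Real.log (4 * Fintype.card V * ks.prod / δ) / G.minDegree)}) := by
  refine ⟨GraphLift.iterEquiv ks V, ?_⟩
  intro G _ Ω _ μ _ X Y hX hY δ hδ hδ1
  have hk : ks.prod ≠ 0 := List.prod_ne_zero fun h => by
    have := hks 0 h
    omega
  have hcard : (4 * (Fintype.card (V × Fin ks.prod) : ℝ) / δ)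
      = 4 * Fintype.card V * ks.prod / δ := by
    rw [Fintype.card_prod, Fintype.card_fin, Nat.cast_mul, mul_assoc]
  have hP := GraphLift.isRandomCover_randomLift G ks.prod
  have hP' := GraphLift.isRandomCover_iteratedLift G ks
  refine ⟨?_, fun hd => ?_⟩
  · refine (GraphLift.one_sub_le_measureReal_opNorm (GraphLift.iterEquiv ks V)
      (GraphLift.iterEquiv_fst ks) hk hP hP' (c := fun _ => 1) (s := G.maxDegree)
      (Nat.cast_nonneg _) (GraphLift.sum_weight_one_le G) hX hY hδ hδ1).trans
      (measureReal_mono (fun ω hω => ?_) (measure_ne_top μ _))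
    have h := hω.2.2
    rwa [GraphLift.deviation_one_sub, hcard] at h
  · refine (GraphLift.one_sub_le_measureReal_opNorm (GraphLift.iterEquiv ks V)
      (GraphLift.iterEquiv_fst ks) hk hP hP' (c := GraphLift.laplacianWeight G)
      (s := 1 / G.minDegree) (by positivity) (GraphLift.sum_laplacianWeight_le G hd)
      hX hY hδ hδ1).trans (measureReal_mono (fun ω hω => ?_) (measure_ne_top μ _))
    have h := hω.2.2
    rwa [GraphLift.deviation_laplacianWeight_sub _ hω.1 hω.2.1, GraphLift.opNorm_sub_comm, hcard,
      one_div_mul_eq_div] at h
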